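/- Let $\Gamma$ be a finite connected graph (a finite CW complex of dimension at most $1$) with a free involution $\tau$, that is, a continuous map $\tau\colon\Gamma\to\Gamma$ with $\tau\circ\tau=\mathrm{id}$ and $\tau(x)\neq x$ for all $x$. Let $G$ be a space homeomorphic to the circle $S^1$, and let $x_0\in\Gamma$, $g_0\in G$ be arbitrary base points. Write $[\Gamma,G]$ for the set of based homotopy classes of based maps $(\Gamma,x_0)\to(G,g_0)$. The Borsuk–Ulam property is said to hold for $\alpha\in[\Gamma,G]$ if every representative $f\in\alpha$ satisfies $f(x)=f(\tau(x))$ for some $x\in\Gamma$, and to fail for $\alpha$ otherwise. Then $\chi(\Gamma)=-2m$ for some integer $m\ge 0$, and there are a generator $z$ of the infinite cyclic group $\pi_1(G,g_0)$ and elements $\gamma_0,\dots,\gamma_{2m}\in\pi_1(\Gamma,x_0)$ such that the map $$E\colon[\Gamma,G]\to\mathbb{Z}^{2m+1},\qquad \alpha\mapsto(n_0,\dots,n_{2m})\quad\text{where }\alpha_\#(\gamma_i)=z^{n_i},$$ is a bijection, and under this identification $[\Gamma,G]\cong\mathbb{Z}^{2m+1}$ the Borsuk–Ulam property fails precisely for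 the classes that correspond to the tuples $(p,p_1,p_1,p_2,p_2,\dots,p_m,p_m)$ with $p$ odd and $p_1,\dots,p_m\in\mathbb{Z}$ arbitrary. It holds for every other class. -/

import Mathlib

open Set Topology

/-- A finite graph: a CW complex with finitely many vertices (`0`-cells), finitely many edges
(`1`-cells) and no cells of dimension at least `2`. Loops and multiple edges are allowed. -/
class IsFiniteGraph (Γ : Type*) [TopologicalSpace Γ] [CWComplex (univ : Set Γ)] : Prop where
  finite_vertices : Finite (RelCWComplex.cell (univ : Set Γ) 0)
  finite_edges : Finite (RelCWComplex.cell (univ : Set Γ) 1)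
  isEmpty_cell (n : ℕ) (hn : 2 ≤ n) : IsEmpty (RelCWComplex.cell (univ : Set Γ) n)

/-- The Euler characteristic of a finite graph: number of vertices minus number of edges. -/
noncomputable def graphEulerChar (Γ : Type*) [TopologicalSpace Γ] [CWComplex (univ : Set Γ)] : ℤ :=
  (Nat.card (RelCWComplex.cell (univ : Set Γ) 0) : ℤ) -
    (Nat.card (RelCWComplex.cell (univ : Set Γ) 1) : ℤ)

/-- A free involution: a continuous involution without fixed points. -/
structure IsFreeInvolution {M : Type*} [TopologicalSpace M] (τ : M → M) : Prop where
  continuous : Continuous τ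
  involutive : Function.Involutive τ
  apply_ne (x : M) : τ x ≠ x

/-- Continuous maps `(M, x₀) → (N, y₀)` that preserve the base points. -/
def BasedMap {M N : Type*} [TopologicalSpace M] [TopologicalSpace N] (x₀ : M) (y₀ : N) :=
  {f : C(M, N) // f x₀ = y₀}

/-- Based homotopy: homotopy that is stationary on the base point. -/
def basedHomotopy {M N : Type*} [TopologicalSpace M] [TopologicalSpace N] (x₀ : M) (y₀ : N) :
    Setoid (BasedMap x₀ y₀) where
  r f g := ContinuousMap.HomotopicRel f.1 g.1 {x₀}
  iseqv :=
    { refl := fun f => ContinuousMap.HomotopicRel.refl f.1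
      symm := fun h => ContinuousMap.HomotopicRel.symm h
      trans := fun h k => ContinuousMap.HomotopicRel.trans h k }

/-- The set `[M, N]` of based homotopy classes of based maps `(M, x₀) → (N, y₀)`. -/
def BasedHomotopyClass {M N : Type*} [TopologicalSpace M] [TopologicalSpace N]
    (x₀ : M) (y₀ : N) :=
  Quotient (basedHomotopy x₀ y₀)

/-- The based homotopy class of a based map. -/
def BasedMap.toClass {M N : Type*} [TopologicalSpace M] [TopologicalSpace N] {x₀ : M} {y₀ : N}
    (f : BasedMap x₀ y₀) : BasedHomotopyClass x₀ y₀ :=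
  Quotient.mk (basedHomotopy x₀ y₀) f

/-- The homomorphism `π₁(M, x₀) → π₁(N, y₀)` induced by a based map. -/
noncomputable def BasedMap.induced {M N : Type*} [TopologicalSpace M] [TopologicalSpace N]
    {x₀ : M} {y₀ : N} (f : BasedMap x₀ y₀) :
    FundamentalGroup M x₀ →* FundamentalGroup N y₀ :=
  FundamentalGroup.mapOfEq f.1 f.2

/-- The Borsuk-Ulam property of a based homotopy class `α` with respect to `τ`: every
representative of `α` identifies some point `x` with `τ x`. -/
def BorsukUlamHolds {M N : Type*} [TopologicalSpace M] [TopologicalSpace N] {x₀ : M} {y₀ : N}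
    (τ : M → M) (α : BasedHomotopyClass x₀ y₀) : Prop :=
  ∀ f : BasedMap x₀ y₀, f.toClass = α → ∃ x : M, f.1 x = f.1 (τ x)

/-! Lift through `turn : ℝ → Circle` and measure a circle-valued map by its winding along paths. If
`f x ≠ f (τ x)` for all `x`, then `f ∘ τ / f` misses `1` and lifts to `θ : X → (0, 1)`. Since `θ + θ
∘ τ` is an integer strictly between `0` and `2`, it is `1`. Hence `f` and `f ∘ τ` wind equally along
every loop, and for a path `c` from `x₀` to `τ x₀` the loop `c · τc` has odd winding
(`exists_odd_of_forall_ne`). Conversely, if these conditions hold on a suitable system of loops, `f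
∘ τ / f` lifts to `θ` with `θ + θ ∘ τ` a constant odd integer `k`. Multiplying `f` by `turn ((θ - θ
x₀) / 2)` is a based homotopy that makes the quotient constantly `turn (k / 2) ≠ 1`
(`exists_homotopicRel_forall_ne`).

What remains is a system of loops `c · τc`, `gᵢ`, `c · τgᵢ · c⁻¹` whose windings classify maps to
the circle. After subdivision `τ` permutes vertices and edges freely. A maximal tree disjoint from
its translate meets every vertex orbit once; an edge `e₀` joins it to its translate and yields `c`.
The edge orbits outside the tree orbits and that of `e₀` yield the `gᵢ`, and counting orbits gives
the Euler characteristic (`IsHalfTree.exists_equivariantLoopBasis`). -/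

open scoped unitInterval

/-! ### The covering of the circle by the line, and winding of paths -/

/-- The universal covering `t ↦ exp (2πit)` of the circle. -/
noncomputable def turn : C(ℝ, Circle) :=
  Circle.exp.comp ⟨fun t => 2 * Real.pi * t, by fun_prop⟩

lemma turn_def (t : ℝ) : turn t = Circle.exp (2 * Real.pi * t) := rfl

@[simp] lemma turn_zero : turn 0 = 1 := by simp [turn_def]

lemma turn_add (s t : ℝ) : turn (s + t) = turn s * turn t := by
  simp [turn_def, mul_add]

lemma turn_neg (t : ℝ) : turn (-t) = (turn t)⁻¹ := by
  simp [turn_def]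

lemma turn_sub (s t : ℝ) : turn (s - t) = turn s / turn t := by
  simp [turn_def, mul_sub]

lemma turn_eq_one_iff {t : ℝ} : turn t = 1 ↔ ∃ n : ℤ, t = n := by
  rw [turn_def, Circle.exp_eq_one]
  refine exists_congr fun n => ?_
  rw [mul_comm (n : ℝ), mul_right_inj' (by positivity)]

lemma turn_intCast (n : ℤ) : turn n = 1 := turn_eq_one_iff.2 ⟨n, rfl⟩

lemma turn_half_ne_one : turn (1 / 2) ≠ 1 := by
  rw [turn_def]
  convert Circle.exp_pi_ne_one using 2
  ring

/-- A continuous real function with integer values on a preconnected space is constant. -/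
lemma eq_of_forall_turn_eq_one {X : Type*} [TopologicalSpace X] [PreconnectedSpace X]
    {θ : X → ℝ} (hθ : Continuous θ) (h : ∀ x, turn (θ x) = 1) (x y : X) : θ x = θ y := by
  choose n hn using fun x => turn_eq_one_iff.1 (h x)
  have hc : Continuous n := by
    rw [Int.isClosedEmbedding_coe_real.isEmbedding.continuous_iff]
    convert hθ using 1
    exact (funext hn).symm
  rw [hn, hn, PreconnectedSpace.constant ‹_› hc]

lemma exists_lift_turn (g : C(I, Circle)) : ∃ F : C(I, ℝ), ∀ t, turn (F t) = g t := by
  obtain ⟨L, hL, -⟩ := Circle.isCoveringMap_exp.exists_path_lifts g (Complex.arg (g 0))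
    (Circle.exp_arg _).symm
  refine ⟨⟨fun t => L t / (2 * Real.pi), by fun_prop⟩, fun t => ?_⟩
  have : (2 * Real.pi) ≠ 0 := by positivity
  simp only [turn_def, ContinuousMap.coe_mk, mul_div_cancel₀ _ this]
  exact congr_fun hL t

/-- The total winding of a path in the circle, measured in turns. -/
noncomputable def winding (g : C(I, Circle)) : ℝ :=
  (exists_lift_turn g).choose 1 - (exists_lift_turn g).choose 0

/-- Two lifts of one path differ by a continuous integer-valued function, hence by a constant; so
any lift computes the winding. -/
lemma winding_eq {g : C(I, Circle)} {F : I → ℝ} (hF : Continuous F) (h : ∀ t, turn (F t) = g t) :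
    winding g = F 1 - F 0 := by
  have key := eq_of_forall_turn_eq_one (θ := fun t => F t - (exists_lift_turn g).choose t)
    (by fun_prop) (fun t => by
      rw [turn_sub, h, (exists_lift_turn g).choose_spec, div_self']) 0 1
  simp only [winding] at key ⊢
  linarith

/-- Monodromy: lifts of homotopic paths with a common starting point have a common end point. The
covering there is `Circle.exp`, whence the division by `2π`. -/
lemma winding_eq_of_homotopicRel {g₀ g₁ : C(I, Circle)} (h : g₀.HomotopicRel g₁ {0, 1}) :
    winding g₀ = winding g₁ := by
  have h0 : g₀ 0 = g₁ 0 := by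
    obtain ⟨H⟩ := h
    rw [← H.eq_fst 0 (.inl rfl), ← H.eq_snd 0 (.inl rfl)]
  have e0 : g₀ 0 = Circle.exp (Complex.arg (g₀ 0)) := (Circle.exp_arg _).symm
  have e1 : g₁ 0 = Circle.exp (Complex.arg (g₀ 0)) := h0 ▸ e0
  have key := Circle.isCoveringMap_exp.liftPath_apply_one_eq_of_homotopicRel h _ e0 e1
  have hp : (2 * Real.pi) ≠ 0 := by positivity
  have aux (g : C(I, Circle)) (a : ℝ) (ha : g 0 = Circle.exp a) :
      winding g = (Circle.isCoveringMap_exp.liftPath g a ha 1 - a) / (2 * Real.pi) := by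
    rw [winding_eq (F := fun t => Circle.isCoveringMap_exp.liftPath g a ha t / (2 * Real.pi))
      (by fun_prop), Circle.isCoveringMap_exp.liftPath_zero, sub_div]
    intro t
    simp only [turn_def, mul_div_cancel₀ _ hp]
    exact congr_fun (Circle.isCoveringMap_exp.liftPath_lifts g a ha) t
  rw [aux g₀ _ e0, aux g₁ _ e1, key]

/-! ### Winding of a circle-valued map along a path -/

section Wind

variable {X Y : Type*} [TopologicalSpace X] [TopologicalSpace Y]

/-- The total winding of `f` along the path `p`. -/
noncomputable def wind (f : C(X, Circle)) {x y : X} (p : Path x y) : ℝ :=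
  winding (f.comp p.toContinuousMap)

lemma wind_eq {f : C(X, Circle)} {x y : X} {p : Path x y} {F : I → ℝ} (hF : Continuous F)
    (h : ∀ t, turn (F t) = f (p t)) : wind f p = F 1 - F 0 :=
  winding_eq hF h

lemma exists_lift_wind (f : C(X, Circle)) {x y : X} (p : Path x y) :
    ∃ F : C(I, ℝ), (∀ t, turn (F t) = f (p t)) ∧ wind f p = F 1 - F 0 := by
  obtain ⟨F, hF⟩ := exists_lift_turn (f.comp p.toContinuousMap)
  exact ⟨F, hF, wind_eq F.continuous hF⟩

lemma turn_wind (f : C(X, Circle)) {x y : X} (p : Path x y) : turn (wind f p) = f y / f x := by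
  obtain ⟨F, hF, h⟩ := exists_lift_wind f p
  rw [h, turn_sub, hF, hF, p.target, p.source]

lemma exists_int_eq_wind (f : C(X, Circle)) {x : X} (p : Path x x) : ∃ n : ℤ, wind f p = n :=
  turn_eq_one_iff.1 (by rw [turn_wind, div_self'])

lemma wind_trans (f : C(X, Circle)) {x y z : X} (p : Path x y) (q : Path y z) :
    wind f (p.trans q) = wind f p + wind f q := by
  obtain ⟨F, hF, h⟩ := exists_lift_wind f p
  obtain ⟨G, hG, h'⟩ := exists_lift_wind f q
  -- The lifts need not match at the junction, but the gap is an integer, so shifting `G` by it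
  -- keeps a lift.
  have hFG : turn (F 1 - G 0) = 1 := by
    rw [turn_sub, hF, hG, p.target, q.source, div_self']
  let P : Path (F 0) (F 1) := ⟨F, rfl, rfl⟩
  let Q : Path (F 1) (G 1 + (F 1 - G 0)) :=
    ⟨⟨fun t => G t + (F 1 - G 0), by fun_prop⟩, by simp, rfl⟩
  rw [wind_eq (P.trans Q).continuous, h, h', (P.trans Q).target, (P.trans Q).source]
  · ring
  · intro t
    simp only [Path.trans_apply]
    split_ifs with ht
    · exact hF _
    · simp only [Q, Path.coe_mk_mk, turn_add, hFG, mul_one, hG]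

@[simp] lemma wind_refl (f : C(X, Circle)) (x : X) : wind f (Path.refl x) = 0 := by
  obtain ⟨F, hF, h⟩ := exists_lift_wind f (Path.refl x)
  rw [h, eq_of_forall_turn_eq_one (θ := fun t => F t - F 0) (by fun_prop) (fun t => ?_) 1 0, sub_self]
  rw [turn_sub, hF, hF]
  simp

lemma wind_symm (f : C(X, Circle)) {x y : X} (p : Path x y) : wind f p.symm = - wind f p := by
  obtain ⟨F, hF, h⟩ := exists_lift_wind f p
  rw [wind_eq (F := fun t => F (unitInterval.symm t)) (by fun_prop), h]
  · simp
  · intro t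
    rw [hF]; rfl

@[simp] lemma wind_cast (f : C(X, Circle)) {x y x' y' : X} (p : Path x y) (hx : x' = x)
    (hy : y' = y) : wind f (p.cast hx hy) = wind f p := rfl

lemma wind_map (f : C(Y, Circle)) (h : C(X, Y)) {x y : X} (p : Path x y) :
    wind f (p.map h.continuous) = wind (f.comp h) p := rfl

lemma wind_mul (f g : C(X, Circle)) {x y : X} (p : Path x y) :
    wind (f * g) p = wind f p + wind g p := by
  obtain ⟨F, hF, h⟩ := exists_lift_wind f p
  obtain ⟨G, hG, h'⟩ := exists_lift_wind g p
  rw [wind_eq (F := fun t => F t + G t) (by fun_prop), h, h']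
  · ring
  · intro t
    rw [turn_add, hF, hG]; rfl

lemma wind_inv (f : C(X, Circle)) {x y : X} (p : Path x y) : wind f⁻¹ p = - wind f p := by
  obtain ⟨F, hF, h⟩ := exists_lift_wind f p
  rw [wind_eq (F := fun t => - F t) (by fun_prop), h]
  · ring
  · intro t
    rw [turn_neg, hF]; rfl

lemma wind_div (f g : C(X, Circle)) {x y : X} (p : Path x y) :
    wind (f / g) p = wind f p - wind g p := by
  rw [div_eq_mul_inv, wind_mul, wind_inv, sub_eq_add_neg]

lemma wind_turn_comp (θ : C(X, ℝ)) {x y : X} (p : Path x y) :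
    wind (turn.comp θ) p = θ y - θ x := by
  rw [wind_eq (F := fun t => θ (p t)) (by fun_prop) (fun t => rfl), p.target, p.source]

lemma wind_eq_of_homotopic (f : C(X, Circle)) {x y : X} {p q : Path x y} (h : p.Homotopic q) :
    wind f p = wind f q :=
  winding_eq_of_homotopicRel (h.map f)

/-- Composing the homotopy with `p` fixes both ends, because the loop starts and ends at the
stationary point. -/
lemma wind_eq_of_homotopicRel {f g : C(X, Circle)} {x : X} (h : f.HomotopicRel g {x})
    (p : Path x x) : wind f p = wind g p := by
  obtain ⟨H⟩ := h
  refine winding_eq_of_homotopicRel ⟨⟨⟨⟨fun s => H (s.1, p s.2), by fun_prop⟩, ?_, ?_⟩, ?_⟩⟩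
  · intro t; simp
  · intro t; simp
  · intro t s hs
    have : p s = x := by rcases hs with rfl | rfl <;> simp
    simpa [this] using H.eq_fst t (x := p s) (by simp [this])

end Wind

/-! ### Circle-valued maps on a space with an involution -/

section CircleMaps

variable {X : Type*} [TopologicalSpace X]

/-- A map to the circle that avoids `1` lifts to a map to the open unit interval. -/
lemma exists_lift_of_ne_one (r : C(X, Circle)) (hr : ∀ x, r x ≠ 1) :
    ∃ θ : C(X, ℝ), (∀ x, θ x ∈ Ioo (0 : ℝ) 1) ∧ ∀ x, turn (θ x) = r x := by
  have hpi := Real.pi_pos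
  -- Negation moves the omitted value `1` to `-1`, which lies on the branch cut of `arg`; the
  -- summand `1 / 2` in the lift undoes it.
  have hne (x : X) : Complex.arg (-(r x : ℂ)) ≠ Real.pi := by
    intro h
    apply hr x
    have h1 := Complex.norm_mul_exp_arg_mul_I (-(r x : ℂ))
    rw [h, norm_neg, Circle.norm_coe, Complex.exp_pi_mul_I] at h1
    ext
    simpa using h1.symm
  have hslit (x : X) : -(r x : ℂ) ∈ Complex.slitPlane := by
    rw [Complex.mem_slitPlane_iff_arg]
    exact ⟨hne x, neg_ne_zero.2 (Circle.coe_ne_zero _)⟩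
  have hcont : Continuous fun x => Complex.arg (-(r x : ℂ)) :=
    continuous_iff_continuousAt.2 fun x =>
      (Complex.continuousAt_arg (hslit x)).comp (f := fun x => -(r x : ℂ))
        (by fun_prop)
  refine ⟨⟨fun x => Complex.arg (-(r x : ℂ)) / (2 * Real.pi) + 1 / 2, by fun_prop⟩,
    fun x => ?_, fun x => ?_⟩
  · have h1 := Complex.neg_pi_lt_arg (-(r x : ℂ))
    have h2 := lt_of_le_of_ne (Complex.arg_le_pi (-(r x : ℂ))) (hne x)
    simp only [ContinuousMap.coe_mk, mem_Ioo]
    constructor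
    · have : -(1 / 2) < Complex.arg (-(r x : ℂ)) / (2 * Real.pi) := by
        rw [lt_div_iff₀ (by positivity)]; linarith
      linarith
    · have : Complex.arg (-(r x : ℂ)) / (2 * Real.pi) < 1 / 2 := by
        rw [div_lt_iff₀ (by positivity)]; linarith
      linarith
  · simp only [ContinuousMap.coe_mk, turn_def]
    have h : 2 * Real.pi * (Complex.arg (-(r x : ℂ)) / (2 * Real.pi) + 1 / 2)
        = Complex.arg (-(r x : ℂ)) + Real.pi := by field_simp
    ext
    have h1 := Complex.norm_mul_exp_arg_mul_I (-(r x : ℂ))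
    rw [norm_neg, Circle.norm_coe] at h1
    rw [h, Circle.coe_exp]
    push_cast
    rw [add_mul, Complex.exp_add, Complex.exp_pi_mul_I]
    simp only [Complex.ofReal_one, one_mul] at h1
    rw [h1]; ring

/-- If `f ∘ τ / f` lifts to the reals through a map `θ`, then the winding of `f` along a path `c`
from `x` to `τ x` followed by its translate is congruent to `θ x + θ (τ x)` modulo `2`. -/
lemma exists_wind_add_wind_comp {τ : C(X, X)} {f : C(X, Circle)} {θ : C(X, ℝ)}
    (hθ : ∀ x, f (τ x) = f x * turn (θ x)) {x : X} (c : Path x (τ x)) :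
    ∃ j : ℤ, wind f c + wind (f.comp τ) c = 2 * j + (θ x + θ (τ x)) := by
  have h1 : f.comp τ = f * turn.comp θ := ContinuousMap.ext hθ
  obtain ⟨j, hj⟩ : ∃ j : ℤ, wind f c - θ x = j := turn_eq_one_iff.1 <| by
    rw [turn_sub, turn_wind, hθ, mul_div_cancel_left, div_self']
  refine ⟨j, ?_⟩
  rw [h1, wind_mul, wind_turn_comp]
  linarith

/-- Necessity. The lift `θ` of `f ∘ τ / f` takes values in `(0, 1)`, which forces `θ x + θ (τ x) =
1`; this is the source of the odd parity. A real-valued lift contributes nothing along a loop. -/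
lemma exists_odd_of_forall_ne {τ : C(X, X)} [PreconnectedSpace X] (hτ : ∀ x, τ (τ x) = x)
    {f : C(X, Circle)} (hf : ∀ x, f x ≠ f (τ x)) {x : X} (c : Path x (τ x)) :
    (∃ k : ℤ, Odd k ∧ wind f c + wind (f.comp τ) c = k) ∧
      ∀ p : Path x x, wind f p = wind (f.comp τ) p := by
  obtain ⟨θ, hθ, hθr⟩ := exists_lift_of_ne_one (f.comp τ / f) fun x h =>
    hf x (div_eq_one.1 h).symm
  have hθ' (x : X) : f (τ x) = f x * turn (θ x) := by
    rw [hθr]; exact (mul_div_cancel _ _).symm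
  refine ⟨?_, fun p => ?_⟩
  · obtain ⟨j, hj⟩ := exists_wind_add_wind_comp hθ' c
    have h1 : turn (θ x + θ (τ x)) = 1 := by
      have h2 := hθ' (τ x)
      rw [hτ, hθ' x, mul_assoc, left_eq_mul] at h2
      rw [turn_add, h2]
    obtain ⟨n, hn⟩ := turn_eq_one_iff.1 h1
    have hn1 : n = 1 := by
      have h2 : (0 : ℝ) < n := by linarith [(hθ x).1, (hθ (τ x)).1]
      have h3 : (n : ℝ) < 2 := by linarith [(hθ x).2, (hθ (τ x)).2]
      have h4 : 0 < n := by exact_mod_cast h2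
      have h5 : n < 2 := by exact_mod_cast h3
      omega
    refine ⟨2 * j + 1, ⟨j, rfl⟩, ?_⟩
    rw [hj, hn, hn1]; push_cast; ring
  · have h1 : f.comp τ = f * turn.comp θ := ContinuousMap.ext hθ'
    rw [h1, wind_mul, wind_turn_comp, sub_self, add_zero]

/-- Loops which detect the homotopy classes of maps from a space with an involution `τ` to the
circle, in the form `c · τ c`, `g₁`, `c · τ g₁ · c⁻¹`, …, `g_m`, `c · τ g_m · c⁻¹`. -/
structure EquivariantLoopBasis (τ : C(X, X)) (x₀ : X) (m : ℕ) where
  /-- a path from the base point to its translate -/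
  c : Path x₀ (τ x₀)
  /-- loops at the base point -/
  g : Fin m → Path x₀ x₀
  exists_lift (f : C(X, Circle)) : wind f c + wind (f.comp τ) c = 0 → (∀ i, wind f (g i) = 0) →
    (∀ i, wind (f.comp τ) (g i) = 0) → ∃ θ : C(X, ℝ), θ x₀ = 0 ∧ ∀ x, f x = f x₀ * turn (θ x)
  exists_map (n : ℤ) (a b : Fin m → ℤ) : ∃ f : C(X, Circle), f x₀ = 1 ∧
    wind f c + wind (f.comp τ) c = n ∧ (∀ i, wind f (g i) = a i) ∧
    ∀ i, wind (f.comp τ) (g i) = b i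

/-- Scale `θ` linearly from `0` to `1`. -/
lemma homotopicRel_mul_turn (f : C(X, Circle)) {θ : C(X, ℝ)} {x₀ : X} (h : θ x₀ = 0) :
    f.HomotopicRel (f * turn.comp θ) {x₀} := by
  refine ⟨⟨⟨⟨fun s => f s.2 * turn (s.1 * θ s.2), by fun_prop⟩, ?_, ?_⟩, ?_⟩⟩
  · intro x; simp
  · intro x; simp
  · rintro t x rfl; simp [h]

/-- Sufficiency: `f` is deformed until `f ∘ τ / f` is constant and different from `1`. -/
lemma EquivariantLoopBasis.exists_homotopicRel_forall_ne [PreconnectedSpace X] {τ : C(X, X)}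
    {x₀ : X} {m : ℕ} (B : EquivariantLoopBasis τ x₀ m) (hτ : ∀ x, τ (τ x) = x) {f : C(X, Circle)}
    {n : ℤ} (hn : Odd n) (hfn : wind f B.c + wind (f.comp τ) B.c = n)
    (hfg : ∀ i, wind f (B.g i) = wind (f.comp τ) (B.g i)) :
    ∃ f' : C(X, Circle), f.HomotopicRel f' {x₀} ∧ ∀ x, f' x ≠ f' (τ x) := by
  -- As the quotient is inverted by `τ`, its winding along `c · τc` cancels for every `f`; only the
  -- loops `g i` impose a condition.
  have hcomp : (f.comp τ / f).comp τ = (f.comp τ / f)⁻¹ := by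
    ext x; simp [hτ]
  obtain ⟨θ₀, -, hθ₀⟩ := B.exists_lift (f.comp τ / f)
    (by rw [hcomp, wind_inv]; ring) (fun i => by rw [wind_div, hfg, sub_self])
    (fun i => by rw [hcomp, wind_inv, wind_div, hfg, sub_self, neg_zero])
  obtain ⟨a, ha⟩ : ∃ a, turn a = (f.comp τ / f) x₀ :=
    ⟨wind f B.c, by rw [turn_wind]; rfl⟩
  let θ : C(X, ℝ) := ⟨fun x => a + θ₀ x, by fun_prop⟩
  have hθ (x : X) : f (τ x) = f x * turn (θ x) := by
    have := hθ₀ x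
    rw [← ha, ← turn_add] at this
    rw [show θ x = a + θ₀ x from rfl, ← this]
    exact (mul_div_cancel _ _).symm
  have hint (x : X) : turn (θ x + θ (τ x)) = 1 := by
    have h2 := hθ (τ x)
    rw [hτ, hθ x, mul_assoc, left_eq_mul] at h2
    rw [turn_add, h2]
  obtain ⟨k, hk⟩ := turn_eq_one_iff.1 (hint x₀)
  have hconst (x : X) : θ x + θ (τ x) = k := by
    rw [← hk]
    exact eq_of_forall_turn_eq_one (θ := fun x => θ x + θ (τ x)) (by fun_prop) hint x x₀
  obtain ⟨j, hj⟩ := exists_wind_add_wind_comp hθ B.c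
  have hk_odd : k = n - 2 * j := by
    have : (k : ℝ) = n - 2 * j := by rw [← hfn, hj, hconst]; ring
    exact_mod_cast this
  obtain ⟨l, hl⟩ : Odd k := by
    rw [hk_odd]
    exact hn.sub_even (even_two_mul j)
  -- This choice gives `θ + ψ ∘ τ - ψ = (θ + θ ∘ τ) / 2 = k / 2`, a half-integer as `k` is odd.
  -- Subtracting `θ x₀` keeps the homotopy based.
  let ψ : C(X, ℝ) := ⟨fun x => (θ x - θ x₀) / 2, by fun_prop⟩
  refine ⟨f * turn.comp ψ, homotopicRel_mul_turn f (by simp [ψ]), fun x hx => ?_⟩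
  have h1 : f x * turn (ψ x) = f (τ x) * turn (ψ (τ x)) := hx
  rw [hθ, mul_assoc, mul_right_inj, ← turn_add] at h1
  have h2 : θ x + ψ (τ x) = (l + 1 / 2 : ℝ) + ψ x := by
    have := hconst x
    rw [hl] at this
    push_cast at this
    simp only [ψ, ContinuousMap.coe_mk]
    linarith
  rw [h2, turn_add, turn_add, turn_intCast, one_mul, right_eq_mul] at h1
  exact turn_half_ne_one h1

end CircleMaps

/-! ### The fundamental group of the circle -/

lemma exists_homeomorph_circle_apply_eq_one {G : Type*} [TopologicalSpace G]
    (hG : Nonempty (G ≃ₜ Circle)) (g₀ : G) : ∃ h : G ≃ₜ Circle, h g₀ = 1 := by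
  obtain ⟨h⟩ := hG
  exact ⟨h.trans (Homeomorph.mulLeft (h g₀)⁻¹), by simp⟩

section Degree

variable {G : Type*} [TopologicalSpace G]

/-- The winding number with respect to a map `h` to the circle, as a homomorphism. -/
noncomputable def windHom (h : C(G, Circle)) (g₀ : G) :
    FundamentalGroup G g₀ →* Multiplicative ℝ where
  toFun p := Multiplicative.ofAdd
    (Quotient.lift (fun p : Path g₀ g₀ => wind h p) (fun _ _ => wind_eq_of_homotopic h) p)
  map_one' := congrArg Multiplicative.ofAdd (wind_refl h g₀)
  map_mul' p q := by
    induction p using Path.Homotopic.Quotient.ind with | mk p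
    induction q using Path.Homotopic.Quotient.ind with | mk q
    -- The order of concatenation in the group law is harmless, as `ℝ` is commutative.
    refine congrArg Multiplicative.ofAdd ((wind_trans h q p).trans (add_comm _ _))

lemma windHom_mk (h : C(G, Circle)) {g₀ : G} (p : Path g₀ g₀) :
    windHom h g₀ (Path.Homotopic.Quotient.mk p) = Multiplicative.ofAdd (wind h p) := rfl

/-- A loop of winding zero has a closed lift, which contracts linearly in `ℝ`. -/
lemma windHom_injective (h : G ≃ₜ Circle) (g₀ : G) :
    Function.Injective (windHom (h : C(G, Circle)) g₀) := by
  rw [injective_iff_map_eq_one]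
  intro p hp
  induction p using Path.Homotopic.Quotient.ind with | mk p
  rw [windHom_mk, ofAdd_eq_one] at hp
  obtain ⟨F, hF, hw⟩ := exists_lift_wind (h : C(G, Circle)) p
  have h0 : F 1 = F 0 := by linarith
  refine Path.Homotopic.Quotient.eq.2 ?_
  refine ⟨⟨⟨⟨fun s => h.symm (turn ((1 - s.1) * F s.2 + s.1 * F 0)), by fun_prop⟩,
    ?_, ?_⟩, ?_⟩⟩
  · intro t; simp [hF]
  · intro t; simp [hF]
  · rintro t s (rfl | rfl)
    · have : (1 - (t : ℝ)) * F 0 + t * F 0 = F 0 := by ring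
      simp [this, hF]
    · have : (1 - (t : ℝ)) * F 1 + t * F 0 = F 0 := by rw [h0]; ring
      simp [this, hF]

lemma exists_windHom_eq_one (h : G ≃ₜ Circle) {g₀ : G} (hg : h g₀ = 1) :
    ∃ z : FundamentalGroup G g₀, windHom (h : C(G, Circle)) g₀ z = Multiplicative.ofAdd 1 := by
  have h0 : h.symm 1 = g₀ := by rw [← hg, h.symm_apply_apply]
  have h1 : turn 1 = 1 := by simpa using turn_intCast 1
  let p : Path g₀ g₀ := ⟨⟨fun t => h.symm (turn t), by fun_prop⟩, by simp [h0], by simp [h0, h1]⟩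
  refine ⟨Path.Homotopic.Quotient.mk p, ?_⟩
  rw [windHom_mk, wind_eq (F := fun t => (t : ℝ)) (by fun_prop) (fun t => by simp [p])]
  simp

lemma exists_generator (h : G ≃ₜ Circle) {g₀ : G} (hg : h g₀ = 1) :
    ∃ z : FundamentalGroup G g₀, Function.Bijective (fun n : ℤ => z ^ n) ∧
      ∀ (p : Path g₀ g₀) (n : ℤ), wind (h : C(G, Circle)) p = n →
        (Path.Homotopic.Quotient.mk p : FundamentalGroup G g₀) = z ^ n := by
  obtain ⟨z, hz⟩ := exists_windHom_eq_one h hg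
  have hzn (n : ℤ) : windHom (h : C(G, Circle)) g₀ (z ^ n) = Multiplicative.ofAdd (n : ℝ) := by
    rw [map_zpow, hz, ← ofAdd_zsmul, zsmul_one]
  have key (p : Path g₀ g₀) (n : ℤ) (hp : wind (h : C(G, Circle)) p = n) :
      (Path.Homotopic.Quotient.mk p : FundamentalGroup G g₀) = z ^ n := by
    apply windHom_injective h
    rw [hzn, windHom_mk, hp]
  refine ⟨z, ⟨fun m n hmn => ?_, fun p => ?_⟩, key⟩
  · have := congrArg (windHom (h : C(G, Circle)) g₀) hmn
    simp only [hzn, EmbeddingLike.apply_eq_iff_eq, Int.cast_inj] at this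
    exact this
  · induction p using Path.Homotopic.Quotient.ind with | mk p
    obtain ⟨n, hn⟩ := exists_int_eq_wind (h : C(G, Circle)) p
    exact ⟨n, (key p n hn).symm⟩

end Degree

/-! ### Homotopy classes as integer tuples -/

lemma BasedMap.induced_mk {M N : Type*} [TopologicalSpace M] [TopologicalSpace N]
    {x₀ : M} {y₀ : N} (f : BasedMap x₀ y₀) (p : Path x₀ x₀) :
    f.induced (Path.Homotopic.Quotient.mk p) =
      Path.Homotopic.Quotient.mk ((p.map f.1.continuous).cast f.2.symm f.2.symm) :=
  FundamentalGroup.mapOfEq_apply _ _ _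

lemma Fin.zero_lt_two_mul_add_one (m : ℕ) : 0 < 2 * m + 1 := Nat.succ_pos _

lemma Fin.two_mul_add_one_lt {m : ℕ} (i : Fin m) : 2 * (i : ℕ) + 1 < 2 * m + 1 := by omega

lemma Fin.two_mul_add_two_lt {m : ℕ} (i : Fin m) : 2 * (i : ℕ) + 2 < 2 * m + 1 := by omega

/-- Case distinction on an index in `Fin (2 * m + 1)`: zero, odd, or even and positive. -/
lemma Fin.forall_two_mul_add_one {m : ℕ} {Q : Fin (2 * m + 1) → Prop} :
    (∀ k, Q k) ↔ Q ⟨0, Fin.zero_lt_two_mul_add_one m⟩ ∧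
      (∀ i : Fin m, Q ⟨2 * i + 1, i.two_mul_add_one_lt⟩) ∧
      ∀ i : Fin m, Q ⟨2 * i + 2, i.two_mul_add_two_lt⟩ := by
  refine ⟨fun h => ⟨h _, fun i => h _, fun i => h _⟩, fun ⟨h0, h1, h2⟩ ⟨k, hk⟩ => ?_⟩
  rcases Nat.eq_zero_or_pos k with rfl | hpos
  · exact h0
  rcases Nat.even_or_odd' k with ⟨j, rfl | rfl⟩
  · have := h2 ⟨j - 1, by omega⟩
    convert this using 2
    simp only
    omega
  · exact h1 ⟨j, by omega⟩

lemma Fin.exists_two_mul_add_one {m : ℕ} {T : Type*} (u : T) (a b : Fin m → T) :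
    ∃ γ : Fin (2 * m + 1) → T, γ ⟨0, Fin.zero_lt_two_mul_add_one m⟩ = u ∧
      (∀ i : Fin m, γ ⟨2 * i + 1, i.two_mul_add_one_lt⟩ = a i) ∧
      ∀ i : Fin m, γ ⟨2 * i + 2, i.two_mul_add_two_lt⟩ = b i := by
  refine ⟨fun k => if h0 : (k : ℕ) = 0 then u else
    if (k : ℕ) % 2 = 1 then a ⟨(k - 1) / 2, by omega⟩ else b ⟨k / 2 - 1, by omega⟩,
    by simp, fun i => ?_, fun i => ?_⟩
  · have h1 : (2 * (i : ℕ) + 1) % 2 = 1 := by omega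
    simp [h1]
  · simp

section Classification

variable {X G : Type*} [TopologicalSpace X] [TopologicalSpace G] {x₀ : X} {g₀ : G}

/-- The loops are `c · τc`, `g i` and `c · τ(g i) · c⁻¹`; in the last, the two passages along `c`
cancel. -/
lemma EquivariantLoopBasis.exists_loops {τ : C(X, X)} {m : ℕ} (B : EquivariantLoopBasis τ x₀ m)
    (hτ : ∀ x, τ (τ x) = x) :
    ∃ γ : Fin (2 * m + 1) → Path x₀ x₀, ∀ f : C(X, Circle),
      wind f (γ ⟨0, Fin.zero_lt_two_mul_add_one m⟩) = wind f B.c + wind (f.comp τ) B.c ∧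
      (∀ i : Fin m, wind f (γ ⟨2 * i + 1, i.two_mul_add_one_lt⟩) = wind f (B.g i)) ∧
      ∀ i : Fin m, wind f (γ ⟨2 * i + 2, i.two_mul_add_two_lt⟩) = wind (f.comp τ) (B.g i) := by
  obtain ⟨γ, h0, h1, h2⟩ := Fin.exists_two_mul_add_one
    (B.c.trans ((B.c.map τ.continuous).cast rfl (hτ x₀).symm)) B.g
    (fun i => (B.c.trans ((B.g i).map τ.continuous)).trans B.c.symm)
  refine ⟨γ, fun f => ⟨?_, fun i => ?_, fun i => ?_⟩⟩
  · rw [h0, wind_trans, wind_cast, wind_map]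
  · rw [h1]
  · rw [h2, wind_trans, wind_trans, wind_map, wind_symm]
    ring

/-- Injectivity of the evaluation comes from `B.exists_lift` applied to a quotient of two maps,
surjectivity from `B.exists_map`; the two halves of the criterion then carry over through `G ≃ₜ
Circle`. -/
lemma exists_classification [PreconnectedSpace X] {τ : C(X, X)} {m : ℕ}
    (B : EquivariantLoopBasis τ x₀ m) (hτ : ∀ x, τ (τ x) = x) (hG : Nonempty (G ≃ₜ Circle)) :
    ∃ (z : FundamentalGroup G g₀) (γ : Fin (2 * m + 1) → FundamentalGroup X x₀)
      (E : BasedHomotopyClass x₀ g₀ ≃ (Fin (2 * m + 1) → ℤ)),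
      Function.Bijective (fun n : ℤ => z ^ n) ∧
      (∀ (f : BasedMap x₀ g₀) (i : Fin (2 * m + 1)), f.induced (γ i) = z ^ E f.toClass i) ∧
      ∀ α : BasedHomotopyClass x₀ g₀, ¬ BorsukUlamHolds τ α ↔
        Odd (E α ⟨0, Fin.zero_lt_two_mul_add_one m⟩) ∧
          ∀ i : Fin m, E α ⟨2 * i + 1, i.two_mul_add_one_lt⟩ =
            E α ⟨2 * i + 2, i.two_mul_add_two_lt⟩ := by
  obtain ⟨h, hg⟩ := exists_homeomorph_circle_apply_eq_one hG g₀
  obtain ⟨z, hz, hzw⟩ := exists_generator h hg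
  obtain ⟨γ, hγ⟩ := B.exists_loops hτ
  let H : C(G, Circle) := h
  have hH1 : H g₀ = 1 := hg
  let ofCircle (f : C(X, Circle)) (hf : f x₀ = 1) : BasedMap x₀ g₀ :=
    ⟨(h.symm : C(Circle, G)).comp f, by simp [hf, ← hg]⟩
  have H_ofCircle (f : C(X, Circle)) (hf : f x₀ = 1) : H.comp (ofCircle f hf).1 = f := by
    ext x; simp [H, ofCircle]
  have rel_of (f f' : BasedMap x₀ g₀) (hff : (H.comp f.1).HomotopicRel (H.comp f'.1) {x₀}) :
      f.toClass = f'.toClass := by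
    refine Quotient.sound ?_
    have := hff.map fun F => F.compContinuousMap (h.symm : C(Circle, G))
    have key (f : BasedMap x₀ g₀) : (h.symm : C(Circle, G)).comp (H.comp f.1) = f.1 := by
      ext x; simp [H]
    rw [key, key] at this
    exact this
  choose e he using fun (f : BasedMap x₀ g₀) k => exists_int_eq_wind (H.comp f.1) (γ k)
  have hwd (f f' : BasedMap x₀ g₀) (hff : f.1.HomotopicRel f'.1 {x₀}) : e f = e f' := by
    ext k
    have := wind_eq_of_homotopicRel (hff.map fun F => F.compContinuousMap H) (γ k)
    rw [he, he] at this
    exact_mod_cast this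
  let ev : BasedHomotopyClass x₀ g₀ → Fin (2 * m + 1) → ℤ := Quotient.lift e hwd
  have hev (f : BasedMap x₀ g₀) : ev f.toClass = e f := rfl
  have hbij : Function.Bijective ev := by
    constructor
    · intro α β
      induction α using Quotient.ind with | _ f
      induction β using Quotient.ind with | _ f'
      intro (hff : e f = e f')
      have hw (k) : wind (H.comp f'.1 / H.comp f.1) (γ k) = 0 := by
        rw [wind_div, he, he, hff, sub_self]
      obtain ⟨h0, h1, h2⟩ := hγ (H.comp f'.1 / H.comp f.1)
      obtain ⟨θ, hθ0, hθ⟩ := B.exists_lift _ (h0 ▸ hw _) (fun i => h1 i ▸ hw _)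
        (fun i => h2 i ▸ hw _)
      apply rel_of
      have : H.comp f'.1 = H.comp f.1 * turn.comp θ := by
        ext1 x
        have h3 := hθ x
        simp only [ContinuousMap.div_apply, ContinuousMap.comp_apply, f.2, f'.2, div_self',
          one_mul, div_eq_iff_eq_mul'] at h3
        exact h3
      rw [this]
      exact homotopicRel_mul_turn _ hθ0
    · intro n
      obtain ⟨f, hf, hn0, hn1, hn2⟩ := B.exists_map (n ⟨0, Fin.zero_lt_two_mul_add_one m⟩)
        (fun i => n ⟨2 * i + 1, i.two_mul_add_one_lt⟩)
        (fun i => n ⟨2 * i + 2, i.two_mul_add_two_lt⟩)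
      refine ⟨(ofCircle f hf).toClass, funext ?_⟩
      have hk (k) (hk : wind f (γ k) = n k) : ev (ofCircle f hf).toClass k = n k := by
        rw [hev]
        have := he (ofCircle f hf) k
        rw [H_ofCircle _ hf, hk] at this
        exact_mod_cast this.symm
      obtain ⟨h0, h1, h2⟩ := hγ f
      exact Fin.forall_two_mul_add_one.2 ⟨hk _ (h0.trans hn0), fun i => hk _ ((h1 i).trans (hn1 i)),
        fun i => hk _ ((h2 i).trans (hn2 i))⟩
  refine ⟨z, fun k => Path.Homotopic.Quotient.mk (γ k), Equiv.ofBijective ev hbij, hz,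
    fun f k => ?_, fun α => ?_⟩
  · rw [BasedMap.induced_mk]
    exact hzw _ _ (he f k)
  · induction α using Quotient.ind with | _ f
    change ¬ BorsukUlamHolds τ f.toClass ↔ Odd (e f _) ∧ ∀ i : Fin m, e f _ = e f _
    constructor
    · intro hB
      simp only [BorsukUlamHolds, not_forall, not_exists] at hB
      obtain ⟨f', hf', hne⟩ := hB
      have hee : e f' = e f := congrArg ev hf'
      rw [← hee]
      obtain ⟨⟨k, hk, hkw⟩, hp⟩ := exists_odd_of_forall_ne hτ (f := H.comp f'.1)
        (fun x hx => hne x (h.injective hx)) B.c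
      obtain ⟨h0, h1, h2⟩ := hγ (H.comp f'.1)
      refine ⟨?_, fun i => ?_⟩
      · rw [hkw, he] at h0
        rwa [show e f' _ = k by exact_mod_cast h0]
      · have h3 := (h1 i).trans ((hp _).trans (h2 i).symm)
        rw [he, he] at h3
        exact_mod_cast h3
    · rintro ⟨hodd, heq⟩ hB
      obtain ⟨h0, h1, h2⟩ := hγ (H.comp f.1)
      obtain ⟨f', hff', hne⟩ := B.exists_homotopicRel_forall_ne hτ hodd (f := H.comp f.1)
        (by rw [← h0, he]) (fun i => by rw [← h1, ← h2, he, he, heq])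
      have hf'1 : f' x₀ = 1 := by
        obtain ⟨F⟩ := hff'
        have h3 := (F.eq_fst 0 (mem_singleton x₀)).symm.trans (F.eq_snd 0 (mem_singleton x₀))
        rw [← h3, ContinuousMap.comp_apply, f.2, hH1]
      obtain ⟨x, hx⟩ := hB (ofCircle f' hf'1) (rel_of _ _ (by rw [H_ofCircle _ hf'1]; exact hff'.symm))
      refine hne x ?_
      have := congrArg h hx
      simpa [ofCircle] using this

end Classification

/-! ### Graphs as finitely many points and open arcs -/

/-- A decomposition of a space into finitely many points (`P`) and open arcs, the images of the
open unit interval under the maps `c e`, whose end points lie in `P`. -/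
structure IsGraphDecomposition {X E : Type*} [TopologicalSpace X] (P : Finset X)
    (c : E → C(I, X)) : Prop where
  zero_mem (e : E) : c e 0 ∈ P
  one_mem (e : E) : c e 1 ∈ P
  notMem (e : E) (t : I) : t ∈ Ioo (0 : I) 1 → c e t ∉ P
  inj (e e' : E) (t t' : I) : t ∈ Ioo (0 : I) 1 → t' ∈ Ioo (0 : I) 1 → c e t = c e' t' →
    e = e' ∧ t = t'
  cover (x : X) : x ∈ P ∨ ∃ e, ∃ t ∈ Ioo (0 : I) 1, c e t = x

lemma unitInterval.eq_zero_or_eq_one_or_mem_Ioo (t : I) : t = 0 ∨ t = 1 ∨ t ∈ Ioo (0 : I) 1 := by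
  rcases eq_or_ne t 0 with h | h
  · exact .inl h
  rcases eq_or_ne t 1 with h' | h'
  · exact .inr (.inl h')
  exact .inr (.inr ⟨unitInterval.pos_iff_ne_zero.2 h, unitInterval.lt_one_iff_ne_one.2 h'⟩)

namespace IsGraphDecomposition

variable {X E : Type*} [TopologicalSpace X] {P : Finset X} {c : E → C(I, X)}

/-- Maps out of a graph can be prescribed on the vertices and the edges, provided that the
prescriptions agree at the end points of the edges. -/
lemma exists_glue [T2Space X] [Finite E] (h : IsGraphDecomposition P c) {Y : Type*}
    [TopologicalSpace Y] (φ : X → Y) (ψ : E → C(I, Y)) (h0 : ∀ e, ψ e 0 = φ (c e 0))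
    (h1 : ∀ e, ψ e 1 = φ (c e 1)) :
    ∃ f : C(X, Y), (∀ v ∈ P, f v = φ v) ∧ ∀ e t, f (c e t) = ψ e t := by
  classical
  choose ed pt hpt hc using fun (x : X) (hx : x ∉ P) => (h.cover x).resolve_left hx
  let f : X → Y := fun x => if hx : x ∈ P then φ x else ψ (ed x hx) (pt x hx)
  have hfP (v : X) (hv : v ∈ P) : f v = φ v := dif_pos hv
  have hfE (e : E) (t : I) : f (c e t) = ψ e t := by
    rcases unitInterval.eq_zero_or_eq_one_or_mem_Ioo t with rfl | rfl | ht
    · rw [hfP _ (h.zero_mem e), h0]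
    · rw [hfP _ (h.one_mem e), h1]
    · have hn := h.notMem e t ht
      obtain ⟨h2, h3⟩ := h.inj _ _ _ _ (hpt _ hn) ht (hc _ hn)
      rw [show f (c e t) = _ from dif_neg hn, h2, h3]
  let q : P ⊕ (Σ _ : E, I) → X := Sum.elim Subtype.val fun s => c s.1 s.2
  have hq : Continuous q := continuous_sum_dom.2
    ⟨continuous_subtype_val, continuous_sigma fun e => (c e).continuous⟩
  have hqs : Function.Surjective q := by
    intro x
    rcases h.cover x with hx | ⟨e, t, -, ht⟩
    · exact ⟨.inl ⟨x, hx⟩, rfl⟩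
    · exact ⟨.inr ⟨e, t⟩, ht⟩
  -- A continuous surjection from a compact space to a Hausdorff one is a quotient map, so
  -- continuity can be checked on the pieces.
  have hquot : IsQuotientMap q := hq.isClosedMap.isQuotientMap hq hqs
  refine ⟨⟨f, hquot.continuous_iff.2 (continuous_sum_dom.2 ⟨?_, continuous_sigma fun e => ?_⟩)⟩,
    hfP, hfE⟩
  · exact continuous_of_discreteTopology
  · exact (ψ e).continuous.congr fun t => (hfE e t).symm

lemma comp_equiv {E' : Type*} (h : IsGraphDecomposition P c) (eq : E' ≃ E) :
    IsGraphDecomposition P (c ∘ eq) := by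
  refine ⟨fun e => h.zero_mem _, fun e => h.one_mem _, fun e => h.notMem _,
    fun e e' t t' ht ht' hc => ?_, fun x => ?_⟩
  · obtain ⟨h1, h2⟩ := h.inj _ _ t t' ht ht' hc
    exact ⟨eq.injective h1, h2⟩
  · rcases h.cover x with hx | ⟨e, t, ht, hx⟩
    · exact .inl hx
    · exact .inr ⟨eq.symm e, t, ht, by simpa using hx⟩

end IsGraphDecomposition

/-! ### Arcs from a CW structure -/

section CW

open CWComplex

variable {Γ : Type*} [TopologicalSpace Γ] [CWComplex (univ : Set Γ)]

lemma IsFiniteGraph.openCell_cases [IsFiniteGraph Γ] (x : Γ) :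
    (∃ v : RelCWComplex.cell (univ : Set Γ) 0, x = RelCWComplex.map 0 v ![]) ∨
      ∃ e : RelCWComplex.cell (univ : Set Γ) 1, x ∈ RelCWComplex.openCell 1 e := by
  have hx : x ∈ ⋃ (n : ℕ) (j : RelCWComplex.cell (univ : Set Γ) n), RelCWComplex.openCell n j := by
    rw [CWComplex.iUnion_openCell_eq_complex]; trivial
  simp only [mem_iUnion] at hx
  obtain ⟨n, j, hj⟩ := hx
  match n, j, hj with
  | 0, j, hj =>
    rw [RelCWComplex.openCell_zero_eq_singleton] at hj
    exact .inl ⟨j, hj⟩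
  | 1, j, hj => exact .inr ⟨j, hj⟩
  | n + 2, j, _ => exact ((IsFiniteGraph.isEmpty_cell (Γ := Γ) (n + 2) (by omega)).false j).elim

lemma exists_isGraphDecomposition [T2Space Γ] [IsFiniteGraph Γ] :
    ∃ (P : Finset Γ) (n : ℕ) (c : Fin n → C(I, Γ)), IsGraphDecomposition P c ∧
      (P.card : ℤ) - n = graphEulerChar Γ := by
  classical
  have := IsFiniteGraph.finite_vertices (Γ := Γ)
  have := IsFiniteGraph.finite_edges (Γ := Γ)
  have := Fintype.ofFinite (RelCWComplex.cell (univ : Set Γ) 0)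
  let vert : RelCWComplex.cell (univ : Set Γ) 0 → Γ := fun v => RelCWComplex.map 0 v ![]
  have hvert : Function.Injective vert := fun v w hvw =>
    (RelCWComplex.map_zero_eq_self_iff (univ : Set Γ)).1 hvw
  let P : Finset Γ := Finset.univ.image vert
  have hP (x : Γ) : x ∈ P ↔ ∃ v, vert v = x := by simp [P]
  -- The affine map from `[0, 1]` onto `[-1, 1]`, the closed unit ball on which the characteristic
  -- maps live.
  let par : I → Fin 1 → ℝ := fun t _ => 2 * t - 1
  have hpar (t : I) : dist (par t) 0 = |2 * (t : ℝ) - 1| := by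
    simp [par]
  have hcl (t : I) : par t ∈ Metric.closedBall (0 : Fin 1 → ℝ) 1 := by
    rw [Metric.mem_closedBall, hpar, abs_le]
    constructor <;> linarith [t.2.1, t.2.2]
  have hop (t : I) (ht : t ∈ Ioo (0 : I) 1) : par t ∈ Metric.ball (0 : Fin 1 → ℝ) 1 := by
    rw [Metric.mem_ball, hpar, abs_lt]
    have h1 : (0 : ℝ) < t := ht.1
    have h2 : (t : ℝ) < 1 := ht.2
    constructor <;> linarith
  have hsphere0 : par 0 ∈ Metric.sphere (0 : Fin 1 → ℝ) 1 := by
    rw [Metric.mem_sphere, hpar]; norm_num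
  have hsphere1 : par 1 ∈ Metric.sphere (0 : Fin 1 → ℝ) 1 := by
    rw [Metric.mem_sphere, hpar]; norm_num
  let arc : RelCWComplex.cell (univ : Set Γ) 1 → C(I, Γ) := fun e =>
    ⟨fun t => RelCWComplex.map 1 e (par t),
      (RelCWComplex.continuousOn 1 e).comp_continuous (by fun_prop) hcl⟩
  have hfront (e : RelCWComplex.cell (univ : Set Γ) 1) (x : Γ)
      (hx : x ∈ RelCWComplex.cellFrontier 1 e) : x ∈ P := by
    obtain ⟨J, hJ⟩ := CWComplex.cellFrontier_subset_finite_closedCell 1 e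
    have := hJ hx
    simp only [mem_iUnion] at this
    obtain ⟨m, hm, j, -, hj⟩ := this
    obtain rfl : m = 0 := by omega
    rw [RelCWComplex.closedCell_zero_eq_singleton] at hj
    exact (hP x).2 ⟨j, hj.symm⟩
  have hopen (e : RelCWComplex.cell (univ : Set Γ) 1) (t : I) (ht : t ∈ Ioo (0 : I) 1) :
      arc e t ∈ RelCWComplex.openCell 1 e := mem_image_of_mem _ (hop t ht)
  have hdec : IsGraphDecomposition P arc := by
    refine ⟨fun e => hfront e _ (mem_image_of_mem _ hsphere0),
      fun e => hfront e _ (mem_image_of_mem _ hsphere1), fun e t ht hmem => ?_,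
      fun e e' t t' ht ht' heq => ?_, fun x => ?_⟩
    · obtain ⟨v, hv⟩ := (hP _).1 hmem
      refine (RelCWComplex.disjoint_openCell_of_ne (C := (univ : Set Γ)) (i := e) (j := v)
        (by simp)).le_bot ⟨hopen e t ht, ?_⟩
      rw [← hv, RelCWComplex.openCell_zero_eq_singleton]
      rfl
    · have hee : e = e' := by
        by_contra hne
        refine (RelCWComplex.disjoint_openCell_of_ne (C := (univ : Set Γ)) (i := e) (j := e')
          (by simpa using hne)).le_bot ⟨hopen e t ht, ?_⟩
        exact heq ▸ hopen e' t' ht'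
      subst hee
      refine ⟨rfl, ?_⟩
      have h1 := (RelCWComplex.map 1 e).injOn
        (by rw [RelCWComplex.source_eq]; exact hop t ht)
        (by rw [RelCWComplex.source_eq]; exact hop t' ht') heq
      have h2 : 2 * (t : ℝ) - 1 = 2 * t' - 1 := congr_fun h1 0
      ext
      linarith
    · rcases IsFiniteGraph.openCell_cases x with ⟨v, rfl⟩ | ⟨e, ⟨y, hy, rfl⟩⟩
      · exact .inl ((hP _).2 ⟨v, rfl⟩)
      · right
        have hy' : |y 0| < 1 := by
          rw [Metric.mem_ball, dist_zero_right, pi_norm_lt_iff one_pos] at hy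
          exact hy 0
        rw [abs_lt] at hy'
        refine ⟨e, ⟨(y 0 + 1) / 2, by constructor <;> linarith⟩, ⟨?_, ?_⟩, ?_⟩
        · change (0 : ℝ) < (y 0 + 1) / 2
          linarith
        · change (y 0 + 1) / 2 < (1 : ℝ)
          linarith
        · change RelCWComplex.map 1 e _ = _
          congr 1
          ext i
          rw [Subsingleton.elim i 0]
          simp only [par]
          ring
  let eq := Finite.equivFin (RelCWComplex.cell (univ : Set Γ) 1)
  refine ⟨P, _, arc ∘ eq.symm, hdec.comp_equiv eq.symm, ?_⟩
  rw [graphEulerChar, Finset.card_image_of_injective _ hvert, Finset.card_univ,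
      Nat.card_eq_fintype_card (α := RelCWComplex.cell (univ : Set Γ) 0)]

end CW

/-! ### Subdivision -/

namespace IsGraphDecomposition

variable {X : Type*} [TopologicalSpace X] {P : Finset X}

/-- An edge can be subdivided at an interior point. -/
lemma exists_insert [DecidableEq X] {E : Type*} {c : E → C(I, X)} (h : IsGraphDecomposition P c)
    {x : X} (hx : x ∉ P) :
    ∃ c' : Option E → C(I, X), IsGraphDecomposition (insert x P) c' := by
  classical
  obtain ⟨e₀, t₀, ht₀, rfl⟩ := (h.cover x).resolve_left hx
  have h0 : (0 : ℝ) < t₀ := ht₀.1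
  have h1 : (t₀ : ℝ) < 1 := ht₀.2
  let l : C(I, I) := ⟨fun s => t₀ * s, by fun_prop⟩
  let r : C(I, I) :=
    ⟨fun s => unitInterval.symm (unitInterval.symm t₀ * unitInterval.symm s), by fun_prop⟩
  have hl (s : I) : (l s : ℝ) = t₀ * s := rfl
  have hr (s : I) : (r s : ℝ) = 1 - (1 - t₀) * (1 - s) := rfl
  -- `none` is the part of `e₀` before `t₀` and `some e₀` the part after it; all other edges are
  -- kept.
  let ed : Option E → E := fun a => a.getD e₀
  let ρ : Option E → C(I, I) := fun a =>
    a.elim l fun e => if e = e₀ then r else ContinuousMap.id I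
  have hρ (a : Option E) : a = none ∧ ρ a = l ∧ ed a = e₀ ∨
      a = some e₀ ∧ ρ a = r ∧ ed a = e₀ ∨ a = some (ed a) ∧ ed a ≠ e₀ ∧ ρ a = .id I := by
    rcases a with _ | e
    · exact .inl ⟨rfl, rfl, rfl⟩
    · by_cases he : e = e₀
      · subst he
        exact .inr (.inl ⟨rfl, if_pos rfl, rfl⟩)
      · exact .inr (.inr ⟨rfl, he, if_neg he⟩)
  have lmem (s : I) (hs : s ∈ Ioo (0 : I) 1) : 0 < (l s : ℝ) ∧ (l s : ℝ) < t₀ := by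
    have hs0 : (0 : ℝ) < s := hs.1
    have hs1 : (s : ℝ) < 1 := hs.2
    rw [hl]
    constructor
    · positivity
    · nlinarith
  have rmem (s : I) (hs : s ∈ Ioo (0 : I) 1) : (t₀ : ℝ) < r s ∧ (r s : ℝ) < 1 := by
    have hs0 : (0 : ℝ) < s := hs.1
    have hs1 : (s : ℝ) < 1 := hs.2
    rw [hr]
    constructor <;> nlinarith
  have ρmem (a : Option E) (s : I) (hs : s ∈ Ioo (0 : I) 1) : ρ a s ∈ Ioo (0 : I) 1 := by
    rcases hρ a with ⟨-, h2, -⟩ | ⟨-, h2, -⟩ | ⟨-, -, h2⟩ <;> rw [h2]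
    · exact ⟨(lmem s hs).1, (lmem s hs).2.trans h1⟩
    · exact ⟨h0.trans (rmem s hs).1, (rmem s hs).2⟩
    · exact hs
  have hends (a : Option E) (s : I) (hs : s = 0 ∨ s = 1) :
      c (ed a) (ρ a s) ∈ insert (c e₀ t₀) P := by
    rcases hρ a with ⟨-, h2, h3⟩ | ⟨-, h2, h3⟩ | ⟨-, -, h2⟩ <;> rw [h2] <;> rcases hs with rfl | rfl
    · rw [h3, show l 0 = 0 from mul_zero _]
      exact Finset.mem_insert_of_mem (h.zero_mem _)
    · rw [h3, show l 1 = t₀ from mul_one _]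
      exact Finset.mem_insert_self _ _
    · rw [h3, show r 0 = t₀ from by ext; rw [hr]; simp]
      exact Finset.mem_insert_self _ _
    · rw [h3, show r 1 = 1 from by ext; rw [hr]; simp]
      exact Finset.mem_insert_of_mem (h.one_mem _)
    · exact Finset.mem_insert_of_mem (h.zero_mem _)
    · exact Finset.mem_insert_of_mem (h.one_mem _)
  refine ⟨fun a => (c (ed a)).comp (ρ a), fun a => hends a 0 (.inl rfl),
    fun a => hends a 1 (.inr rfl), fun a s hs hmem => ?_, fun a b s s' hs hs' heq => ?_,
    fun y => ?_⟩
  · rcases Finset.mem_insert.1 hmem with hm | hm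
    · obtain ⟨h2, h3⟩ := h.inj _ _ _ _ (ρmem a s hs) ht₀ hm
      rcases hρ a with ⟨-, h4, -⟩ | ⟨-, h4, -⟩ | ⟨-, h5, -⟩
      · rw [h4] at h3
        exact (lmem s hs).2.ne (congrArg Subtype.val h3)
      · rw [h4] at h3
        exact (rmem s hs).1.ne' (congrArg Subtype.val h3)
      · exact h5 h2
    · exact h.notMem _ _ (ρmem a s hs) hm
  · obtain ⟨h2, h3⟩ := h.inj _ _ _ _ (ρmem a s hs) (ρmem b s' hs') heq
    rcases hρ a with ⟨ha, h4, ha'⟩ | ⟨ha, h4, ha'⟩ | ⟨ha, ha', h4⟩ <;>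
      rcases hρ b with ⟨hb, h5, hb'⟩ | ⟨hb, h5, hb'⟩ | ⟨hb, hb', h5⟩ <;> rw [h4, h5] at h3
    · refine ⟨ha.trans hb.symm, ?_⟩
      have h6 : (t₀ : ℝ) * s = t₀ * s' := congrArg Subtype.val h3
      exact Subtype.ext (mul_left_cancel₀ h0.ne' h6)
    · exact absurd (congrArg Subtype.val h3) ((lmem s hs).2.trans (rmem s' hs').1).ne
    · exact absurd (h2 ▸ ha') hb'
    · exact absurd (congrArg Subtype.val h3) ((lmem s' hs').2.trans (rmem s hs).1).ne'
    · refine ⟨ha.trans hb.symm, ?_⟩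
      have h6 : 1 - (1 - (t₀ : ℝ)) * (1 - s) = 1 - (1 - t₀) * (1 - s') := congrArg Subtype.val h3
      have h7 : (1 - (t₀ : ℝ)) * (1 - s) = (1 - t₀) * (1 - s') := by linarith
      have h8 := mul_left_cancel₀ (sub_pos.2 h1).ne' h7
      ext
      linarith
    · exact absurd (h2 ▸ ha') hb'
    · exact absurd (h2 ▸ hb') ha'
    · exact absurd (h2 ▸ hb') ha'
    · exact ⟨ha.trans ((congrArg some h2).trans hb.symm), h3⟩
  · rcases h.cover y with hy | ⟨e, t, ht, rfl⟩
    · exact .inl (Finset.mem_insert_of_mem hy)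
    by_cases he : e = e₀
    · subst he
      have ht0 : (0 : ℝ) < t := ht.1
      have ht1 : (t : ℝ) < 1 := ht.2
      rcases lt_trichotomy (t : ℝ) t₀ with hlt | heq | hgt
      · refine .inr ⟨none, ⟨t / t₀, by positivity, by rw [div_le_one h0]; exact hlt.le⟩, ⟨?_, ?_⟩, ?_⟩
        · change (0 : ℝ) < t / t₀
          positivity
        · change (t : ℝ) / t₀ < 1
          rwa [div_lt_one h0]
        · change c e (l _) = _
          congr 1
          ext
          rw [hl]
          exact mul_div_cancel₀ _ h0.ne'
      · rw [Subtype.ext heq]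
        exact .inl (Finset.mem_insert_self _ _)
      · have h2 : 0 < 1 - (t₀ : ℝ) := sub_pos.2 h1
        have h3 : 0 < ((t : ℝ) - t₀) / (1 - t₀) := div_pos (sub_pos.2 hgt) h2
        have h4 : ((t : ℝ) - t₀) / (1 - t₀) < 1 := by
          rw [div_lt_one h2]; linarith
        refine .inr ⟨some e, ⟨((t : ℝ) - t₀) / (1 - t₀), h3.le, h4.le⟩, ⟨h3, h4⟩, ?_⟩
        have h5 : ρ (some e) = r := if_pos rfl
        change c e (ρ (some e) _) = _
        rw [h5]
        congr 1
        ext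
        rw [hr]
        field_simp
        ring
    · refine .inr ⟨some e, t, ht, ?_⟩
      have h5 : ρ (some e) = .id I := if_neg he
      change c e (ρ (some e) t) = _
      rw [h5]
      rfl

/-- Each new point adds one vertex and one edge, so the Euler characteristic survives. -/
lemma exists_superset [DecidableEq X] {n : ℕ} {c : Fin n → C(I, X)}
    (h : IsGraphDecomposition P c) (Q : Finset X) :
    ∃ (k : ℕ) (c' : Fin k → C(I, X)), IsGraphDecomposition (P ∪ Q) c' ∧
      ((P ∪ Q).card : ℤ) - k = P.card - n := by
  induction Q using Finset.induction_on with
  | empty => exact ⟨n, c, by simpa using h, by simp⟩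
  | insert x Q hx ih =>
    obtain ⟨k, c', hc', hk⟩ := ih
    rw [Finset.union_insert]
    by_cases hxP : x ∈ P ∪ Q
    · rw [Finset.insert_eq_of_mem hxP]
      exact ⟨k, c', hc', hk⟩
    · obtain ⟨c'', hc''⟩ := hc'.exists_insert hxP
      refine ⟨k + 1, _, hc''.comp_equiv (finSuccEquiv k), ?_⟩
      rw [Finset.card_insert_of_notMem hxP]
      push_cast
      linarith

end IsGraphDecomposition

/-! ### The action of the involution on edges -/

namespace IsGraphDecomposition

variable {X E : Type*} [TopologicalSpace X] {P : Finset X} {c : E → C(I, X)}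

lemma mem_Ioo_of_notMem (h : IsGraphDecomposition P c) {e : E} {t : I} (ht : c e t ∉ P) :
    t ∈ Ioo (0 : I) 1 := by
  rcases unitInterval.eq_zero_or_eq_one_or_mem_Ioo t with rfl | rfl | ht'
  · exact absurd (h.zero_mem e) ht
  · exact absurd (h.one_mem e) ht
  · exact ht'

/-- The complement is a finite union of points and compact arcs. -/
lemma isOpen_image_Ioo [T2Space X] [Finite E] (h : IsGraphDecomposition P c) (e : E) :
    IsOpen (c e '' Ioo 0 1) := by
  have hc : c e '' Ioo 0 1 = ((P : Set X) ∪ ⋃ e' ∈ {e' | e' ≠ e}, range (c e'))ᶜ := by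
    ext x
    simp only [mem_compl_iff, mem_union, Finset.mem_coe, mem_iUnion, mem_ofPred_eq, not_or,
      not_exists]
    constructor
    · rintro ⟨t, ht, rfl⟩
      refine ⟨h.notMem e t ht, fun e' he' ⟨t', ht'⟩ => he' ?_⟩
      have hn : c e' t' ∉ P := ht' ▸ h.notMem e t ht
      exact (h.inj _ _ _ _ (h.mem_Ioo_of_notMem hn) ht ht').1
    · rintro ⟨hx, hx'⟩
      obtain ⟨e', t, ht, rfl⟩ := (h.cover x).resolve_left hx
      obtain rfl : e' = e := by
        by_contra hne
        exact hx' e' hne ⟨t, rfl⟩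
      exact ⟨t, ht, rfl⟩
  rw [hc]
  refine (P.finite_toSet.isClosed.union ((toFinite _).isClosed_biUnion fun e' _ => ?_)).isOpen_compl
  exact (isCompact_range (c e').continuous).isClosed

/-- An involution that preserves the vertices permutes the edges. -/
lemma exists_edge_involution [T2Space X] [Finite E] (h : IsGraphDecomposition P c) {τ : C(X, X)}
    (hτ : ∀ x, τ (τ x) = x) (hP : ∀ x ∈ P, τ x ∈ P) :
    ∃ ι : E → E, (∀ e, ι (ι e) = e) ∧
      ∀ e, ∀ t ∈ Ioo (0 : I) 1, ∃ t' ∈ Ioo (0 : I) 1, c (ι e) t' = τ (c e t) := by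
  have hP' (x : X) (hx : x ∉ P) : τ x ∉ P := fun hx' => hx (hτ x ▸ hP _ hx')
  let half : I := ⟨1 / 2, by norm_num, by norm_num⟩
  have hhalf : half ∈ Ioo (0 : I) 1 :=
    ⟨show (0 : ℝ) < 1 / 2 by norm_num, show (1 / 2 : ℝ) < 1 by norm_num⟩
  choose ι t₀ ht₀ hι using fun e =>
    (h.cover (τ (c e half))).resolve_left (hP' _ (h.notMem e half hhalf))
  have key (e : E) (t : I) (ht : t ∈ Ioo (0 : I) 1) :
      ∃ t' ∈ Ioo (0 : I) 1, c (ι e) t' = τ (c e t) := by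
    -- The translate of an open edge is connected and misses the vertices, so it cannot meet both
    -- the open edge `ι e`, where the midpoint goes, and the union `V` of the others.
    let V : Set X := ⋃ e' ∈ {e' | e' ≠ ι e}, c e' '' Ioo 0 1
    have hV : IsOpen V := isOpen_biUnion fun e' _ => h.isOpen_image_Ioo e'
    have hdisj : Disjoint (c (ι e) '' Ioo 0 1) V := by
      rw [Set.disjoint_left]
      rintro _ ⟨s, hs, rfl⟩ hmem
      simp only [V, mem_iUnion] at hmem
      obtain ⟨e', he', s', hs', heq⟩ := hmem
      exact he' (h.inj _ _ _ _ hs' hs heq).1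
    have hsub : (fun t => τ (c e t)) '' Ioo 0 1 ⊆ c (ι e) '' Ioo 0 1 ∪ V := by
      rintro _ ⟨s, hs, rfl⟩
      obtain ⟨e', s', hs', heq⟩ := (h.cover (τ (c e s))).resolve_left (hP' _ (h.notMem e s hs))
      by_cases he' : e' = ι e
      · subst he'
        exact .inl ⟨s', hs', heq⟩
      · exact .inr (mem_biUnion (show e' ∈ {e' | e' ≠ ι e} from he') ⟨s', hs', heq⟩)
    have hpre : IsPreconnected ((fun t => τ (c e t)) '' Ioo (0 : I) 1) :=
      isPreconnected_Ioo.image _ (by fun_prop)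
    exact hpre.subset_left_of_subset_union (h.isOpen_image_Ioo _) hV hdisj hsub
      ⟨_, ⟨half, hhalf, rfl⟩, ⟨_, ht₀ e, hι e⟩⟩ ⟨t, ht, rfl⟩
  refine ⟨ι, fun e => ?_, key⟩
  obtain ⟨t', ht', heq'⟩ := key (ι e) (t₀ e) (ht₀ e)
  rw [hι, hτ] at heq'
  exact (h.inj _ _ _ _ ht' hhalf heq').1

/-- A fixed-point-free involution does not preserve any edge. -/
lemma false_of_maps_edge_to_itself [T2Space X] (h : IsGraphDecomposition P c) {τ : C(X, X)}
    (hτ : ∀ x, τ (τ x) = x) (hfree : ∀ x, τ x ≠ x) {e : E}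
    (he : ∀ t ∈ Ioo (0 : I) 1, ∃ t' ∈ Ioo (0 : I) 1, c e t' = τ (c e t)) : False := by
  choose g hg hgc using fun t : Ioo (0 : I) 1 => he t t.2
  have hgg (t : Ioo (0 : I) 1) : g ⟨g t, hg t⟩ = t := by
    refine (h.inj e e _ _ (hg _) t.2 ?_).2
    rw [hgc, hgc, hτ]
  have hcont : Continuous g := by
    refine continuous_iff_isClosed.2 fun K hK => ?_
    -- No inverse of `c e` is needed: `c e '' K` is compact, hence closed, and an end point in `K`
    -- adds nothing because it maps to a vertex.
    have hpre : g ⁻¹' K = (fun t : Ioo (0 : I) 1 => τ (c e t)) ⁻¹' (c e '' K) := by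
      ext t
      simp only [mem_preimage]
      constructor
      · exact fun ht => ⟨g t, ht, hgc t⟩
      · rintro ⟨s, hs, heq⟩
        have h1 : c e s = c e (g t) := heq.trans (hgc t).symm
        have h2 : s ∈ Ioo (0 : I) 1 := h.mem_Ioo_of_notMem (h1 ▸ h.notMem e _ (hg t))
        exact (h.inj _ _ _ _ h2 (hg t) h1).2 ▸ hs
    rw [hpre]
    exact (hK.isCompact.image (c e).continuous).isClosed.preimage (by fun_prop)
  have : PreconnectedSpace (Ioo (0 : I) 1) :=
    isPreconnected_iff_preconnectedSpace.1 isPreconnected_Ioo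
  -- Since `g` is an involution, `d` changes sign under `g`; a zero of `d` is a fixed point of `τ`.
  let d : Ioo (0 : I) 1 → ℝ := fun t => (g t : ℝ) - (t : I)
  have hd : Continuous d := by fun_prop
  let t₁ : Ioo (0 : I) 1 := ⟨⟨1 / 2, by norm_num, by norm_num⟩,
    ⟨show (0 : ℝ) < 1 / 2 by norm_num, show (1 / 2 : ℝ) < 1 by norm_num⟩⟩
  have hneg : d ⟨g t₁, hg t₁⟩ = - d t₁ := by
    simp only [d, hgg]
    ring
  obtain ⟨t, ht⟩ : (0 : ℝ) ∈ range d := by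
    rcases le_total (d t₁) 0 with h1 | h1
    · exact mem_range_of_exists_le_of_exists_ge hd ⟨_, h1⟩ ⟨⟨g t₁, hg t₁⟩, by rw [hneg]; linarith⟩
    · exact mem_range_of_exists_le_of_exists_ge hd ⟨⟨g t₁, hg t₁⟩, by rw [hneg]; linarith⟩ ⟨_, h1⟩
  have hfix : g t = t := Subtype.ext (sub_eq_zero.1 ht)
  exact hfree (c e t) ((hgc t).symm.trans (by rw [hfix]))

/-- A decomposition whose vertices are invariant under a free involution can be reparametrized such
that the involution freely permutes the parametrized edges. -/
lemma exists_equivariant [T2Space X] [Finite E] [LinearOrder E] (h : IsGraphDecomposition P c)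
    {τ : C(X, X)} (hτ : ∀ x, τ (τ x) = x) (hfree : ∀ x, τ x ≠ x) (hP : ∀ x ∈ P, τ x ∈ P) :
    ∃ (ι : E → E) (c' : E → C(I, X)), (∀ e, ι (ι e) = e) ∧ (∀ e, ι e ≠ e) ∧
      IsGraphDecomposition P c' ∧ ∀ e t, c' (ι e) t = τ (c' e t) := by
  have hP' (x : X) (hx : x ∉ P) : τ x ∉ P := fun hx' => hx (hτ x ▸ hP _ hx')
  have hinj : Function.Injective τ := (show Function.Involutive τ from hτ).injective
  obtain ⟨ι, hι, hιc⟩ := h.exists_edge_involution hτ hP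
  have hιe (e : E) : ι e ≠ e := fun he =>
    h.false_of_maps_edge_to_itself hτ hfree (e := e) fun t ht => by
      simpa only [he] using hιc e t ht
  -- The smaller edge of each orbit keeps its parametrization, the larger receives the translated
  -- one.
  let c' : E → C(I, X) := fun e => if e < ι e then c e else τ.comp (c (ι e))
  have hc (e : E) : e < ι e ∧ c' e = c e ∨ ι e < e ∧ c' e = τ.comp (c (ι e)) := by
    rcases lt_or_gt_of_ne (hιe e) with he | he
    · exact .inr ⟨he, if_neg he.not_gt⟩
    · exact .inl ⟨he, if_pos he⟩
  refine ⟨ι, c', hι, hιe, ⟨fun e => ?_, fun e => ?_, fun e t ht => ?_,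
    fun e e' t t' ht ht' heq => ?_, fun x => ?_⟩, fun e t => ?_⟩
  · rcases hc e with ⟨-, h1⟩ | ⟨-, h1⟩ <;> rw [h1]
    exacts [h.zero_mem e, hP _ (h.zero_mem _)]
  · rcases hc e with ⟨-, h1⟩ | ⟨-, h1⟩ <;> rw [h1]
    exacts [h.one_mem e, hP _ (h.one_mem _)]
  · rcases hc e with ⟨-, h1⟩ | ⟨-, h1⟩ <;> rw [h1]
    exacts [h.notMem e t ht, hP' _ (h.notMem _ t ht)]
  · have hmem (e : E) (t : I) (ht : t ∈ Ioo (0 : I) 1) : ∃ s ∈ Ioo (0 : I) 1, c e s = c' e t := by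
      rcases hc e with ⟨-, h1⟩ | ⟨-, h1⟩ <;> rw [h1]
      · exact ⟨t, ht, rfl⟩
      · simpa only [hι, ContinuousMap.comp_apply] using hιc (ι e) t ht
    obtain ⟨s, hs, h1⟩ := hmem e t ht
    obtain ⟨s', hs', h1'⟩ := hmem e' t' ht'
    obtain rfl : e = e' := (h.inj _ _ _ _ hs hs' (h1.trans (heq.trans h1'.symm))).1
    refine ⟨rfl, ?_⟩
    rcases hc e with ⟨-, h1⟩ | ⟨-, h1⟩ <;> rw [h1] at heq
    exacts [(h.inj _ _ _ _ ht ht' heq).2, (h.inj _ _ _ _ ht ht' (hinj heq)).2]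
  · rcases h.cover x with hx | ⟨e, t, ht, rfl⟩
    · exact .inl hx
    · right
      rcases hc e with ⟨-, h1⟩ | ⟨-, h1⟩
      · exact ⟨e, t, ht, by rw [h1]⟩
      · obtain ⟨s, hs, h2⟩ := hιc e t ht
        exact ⟨e, s, hs, by rw [h1, ContinuousMap.comp_apply, h2, hτ]⟩
  · rcases hc e with ⟨h0, h1⟩ | ⟨h0, h1⟩ <;> rcases hc (ι e) with ⟨h0', h1'⟩ | ⟨h0', h1'⟩ <;>
      rw [hι] at h0'
    · exact absurd h0' h0.not_gt
    · rw [h1, h1', hι, ContinuousMap.comp_apply]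
    · rw [h1, h1', ContinuousMap.comp_apply, hτ]
    · exact absurd h0' h0.not_gt

end IsGraphDecomposition

/-! ### Trees meeting each vertex orbit once -/

/-- A parametrized edge, as a path between its end points. -/
def edgePath {X E : Type*} [TopologicalSpace X] (c : E → C(I, X)) (e : E) :
    Path (c e 0) (c e 1) := ⟨c e, rfl, rfl⟩

lemma wind_edgePath_comp {X E : Type*} [TopologicalSpace X] {c : E → C(I, X)} {τ : C(X, X)}
    {ι : E → E} (hc : ∀ e t, c (ι e) t = τ (c e t)) (f : C(X, Circle)) (e : E) :
    wind f (edgePath c (ι e)) = wind (f.comp τ) (edgePath c e) := by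
  have h : c (ι e) = τ.comp (c e) := ContinuousMap.ext (hc e)
  change winding (f.comp (c (ι e))) = winding ((f.comp τ).comp (c e))
  rw [h, ContinuousMap.comp_assoc]

namespace IsGraphDecomposition

variable {X E : Type*} [TopologicalSpace X] {P : Finset X} {c : E → C(I, X)}

/-- Otherwise the indicator of `W` on the vertices extends, constant along each edge, to a
nonconstant continuous map to `Bool`. -/
lemma exists_edge_leaving [T2Space X] [PreconnectedSpace X] [Finite E]
    (h : IsGraphDecomposition P c) {W : Set X} {v w : X} (hvP : v ∈ P) (hwP : w ∈ P)
    (hv : v ∈ W) (hw : w ∉ W) :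
    ∃ e, c e 0 ∈ W ∧ c e 1 ∉ W ∨ c e 1 ∈ W ∧ c e 0 ∉ W := by
  classical
  by_contra! hcon
  have hW (e : E) : c e 0 ∈ W ↔ c e 1 ∈ W := ⟨(hcon e).1, (hcon e).2⟩
  obtain ⟨f, hfP, -⟩ := h.exists_glue (fun x => decide (x ∈ W))
    (fun e => ContinuousMap.const I (decide (c e 0 ∈ W))) (fun e => rfl)
    (fun e => by simp [hW])
  have := PreconnectedSpace.constant ‹_› f.continuous (x := v) (y := w)
  rw [hfP v hvP, hfP w hwP] at this
  simp [hv, hw] at this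

lemma pathConnectedSpace [T2Space X] [PreconnectedSpace X] [Finite E]
    (h : IsGraphDecomposition P c) {x₀ : X} (hx₀ : x₀ ∈ P) : PathConnectedSpace X := by
  have hP (v : X) (hv : v ∈ P) : Joined x₀ v := by
    by_contra hn
    obtain ⟨e, ⟨h0, h1⟩ | ⟨h1, h0⟩⟩ :=
      h.exists_edge_leaving (W := {x | Joined x₀ x}) hx₀ hv (Joined.refl x₀) hn
    · exact h1 (Joined.trans h0 ⟨edgePath c e⟩)
    · exact h0 (Joined.trans h1 ⟨(edgePath c e).symm⟩)
  have hall (x : X) : Joined x₀ x := by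
    rcases h.cover x with hx | ⟨e, t, -, rfl⟩
    · exact hP x hx
    · exact (hP _ (h.zero_mem e)).trans
        ⟨⟨fun s => c e (s * t), by fun_prop⟩, by simp, by simp⟩
  exact ⟨⟨x₀⟩, fun x y => (hall x).symm.trans (hall y)⟩

end IsGraphDecomposition

/-- A tree with vertices `S` and edges `B` inside a graph with an involution `τ`, which is disjoint
from its translate by `τ`, together with a choice of paths from the root `x₀` to its vertices. -/
structure IsHalfTree {X E : Type*} [TopologicalSpace X] (P : Finset X) (c : E → C(I, X))
    (τ : C(X, X)) (x₀ : X) (S : Finset X) (B : Finset E) (p : ∀ v, Path x₀ v) : Prop where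
  root : x₀ ∈ S
  subset : S ⊆ P
  notMem (v : X) : v ∈ S → τ v ∉ S
  card : S.card = B.card + 1
  zero_mem (e : E) : e ∈ B → c e 0 ∈ S
  one_mem (e : E) : e ∈ B → c e 1 ∈ S
  wind_root (f : C(X, Circle)) : wind f (p x₀) = 0
  wind_edge (f : C(X, Circle)) (e : E) : e ∈ B →
    wind f (edgePath c e) = wind f (p (c e 1)) - wind f (p (c e 0))
  wind_eq_zero (f : C(X, Circle)) : (∀ e ∈ B, wind f (edgePath c e) = 0) → ∀ v ∈ S,
    wind f (p v) = 0

namespace IsHalfTree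

variable {X E : Type*} [TopologicalSpace X] {P : Finset X} {c : E → C(I, X)} {τ : C(X, X)} {x₀ : X}
  {S : Finset X} {B : Finset E} {p : ∀ v, Path x₀ v}

/-- The path to the new vertex is the tree path to `u` followed by the edge, traversed backwards if
`u` is its end; hence the sign in `q`. -/
lemma exists_insert [DecidableEq X] [DecidableEq E] (h : IsHalfTree P c τ x₀ S B p)
    (hτ : ∀ x, τ (τ x) = x) (hfree : ∀ x, τ x ≠ x) {e : E} {u v : X} (hu : u ∈ S) (hvP : v ∈ P)
    (hv : v ∉ S) (hτv : τ v ∉ S)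
    (huv : u = c e 0 ∧ v = c e 1 ∨ u = c e 1 ∧ v = c e 0) :
    ∃ p', IsHalfTree P c τ x₀ (insert v S) (insert e B) p' := by
  obtain ⟨q, hq⟩ : ∃ q : Path u v,
      ∀ f, wind f q = wind f (edgePath c e) ∧ u = c e 0 ∧ v = c e 1 ∨
        wind f q = - wind f (edgePath c e) ∧ u = c e 1 ∧ v = c e 0 := by
    rcases huv with ⟨rfl, rfl⟩ | ⟨rfl, rfl⟩
    · exact ⟨edgePath c e, fun f => .inl ⟨rfl, rfl, rfl⟩⟩
    · exact ⟨(edgePath c e).symm, fun f => .inr ⟨wind_symm _ _, rfl, rfl⟩⟩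
  have heB : e ∉ B := fun he => by
    rcases huv with ⟨-, h2⟩ | ⟨-, h2⟩
    exacts [hv (h2 ▸ h.one_mem e he), hv (h2 ▸ h.zero_mem e he)]
  let p' := Function.update p v ((p u).trans q)
  have hp'v : p' v = (p u).trans q := Function.update_self ..
  have hp' (w : X) (hw : w ∈ S) : p' w = p w :=
    Function.update_of_ne (fun hwv : w = v => hv (hwv ▸ hw)) _ _
  have hends : c e 0 ∈ insert v S ∧ c e 1 ∈ insert v S := by
    rcases huv with ⟨rfl, rfl⟩ | ⟨rfl, rfl⟩ <;> simp [hu]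
  refine ⟨p', Finset.mem_insert_of_mem h.root, Finset.insert_subset hvP h.subset,
    fun w hw hw' => ?_, ?_, fun e' he' => ?_, fun e' he' => ?_, fun f => ?_, fun f e' he' => ?_,
    fun f hf w hw => ?_⟩
  · rcases Finset.mem_insert.1 hw with rfl | hw <;> rcases Finset.mem_insert.1 hw' with hw' | hw'
    · exact hfree _ hw'
    · exact hτv hw'
    · exact hτv (by rwa [← hw', hτ])
    · exact h.notMem w hw hw'
  · rw [Finset.card_insert_of_notMem hv, Finset.card_insert_of_notMem heB, h.card]
  · rcases Finset.mem_insert.1 he' with rfl | he'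
    exacts [hends.1, Finset.mem_insert_of_mem (h.zero_mem _ he')]
  · rcases Finset.mem_insert.1 he' with rfl | he'
    exacts [hends.2, Finset.mem_insert_of_mem (h.one_mem _ he')]
  · rw [hp' _ h.root, h.wind_root]
  · rcases Finset.mem_insert.1 he' with rfl | he'
    · have h1 : wind f (p' v) = wind f (p' u) + wind f q := by
        rw [hp'v, wind_trans, hp' u hu]
      rcases hq f with ⟨h2, h3, h4⟩ | ⟨h2, h3, h4⟩
      · rw [h2] at h1
        have key : ∀ a b, u = a → v = b → wind f (p' b) = wind f (p' a) + wind f (edgePath c e') := by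
          rintro _ _ rfl rfl; exact h1
        have := key _ _ h3 h4
        linarith
      · rw [h2] at h1
        have key : ∀ a b, u = a → v = b →
            wind f (p' b) = wind f (p' a) + -wind f (edgePath c e') := by
          rintro _ _ rfl rfl; exact h1
        have := key _ _ h3 h4
        linarith
    · rw [hp' _ (h.zero_mem _ he'), hp' _ (h.one_mem _ he'), h.wind_edge f _ he']
  · have h0 := h.wind_eq_zero f fun e' he' => hf e' (Finset.mem_insert_of_mem he')
    rcases Finset.mem_insert.1 hw with rfl | hw
    · have h1 := hf e (Finset.mem_insert_self _ _)
      rw [hp'v, wind_trans, h0 u hu]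
      rcases hq f with ⟨h2, -⟩ | ⟨h2, -⟩ <;> rw [h2, h1] <;> simp
    · rw [hp' w hw, h0 w hw]

/-- In a connected graph with a free involution, there is a tree that contains exactly one vertex
of each orbit. -/
lemma exists_spanning [T2Space X] [PreconnectedSpace X] [Finite E]
    (h : IsGraphDecomposition P c) (hτ : ∀ x, τ (τ x) = x) (hfree : ∀ x, τ x ≠ x)
    (hP : ∀ x ∈ P, τ x ∈ P) {ι : E → E} (hι : ∀ e t, c (ι e) t = τ (c e t)) (hx₀ : x₀ ∈ P) :
    ∃ S B p, IsHalfTree P c τ x₀ S B p ∧ ∀ v ∈ P, v ∈ S ∨ τ v ∈ S := by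
  classical
  have := h.pathConnectedSpace hx₀
  -- A tree with the most vertices is taken. If it missed an orbit, an edge would lead from `S ∪ τS`
  -- to a missed orbit; translated by `τ` if necessary, it would extend the tree.
  let T : Finset (Finset X) := P.powerset.filter fun S => ∃ B p, IsHalfTree P c τ x₀ S B p
  have hT (S : Finset X) : S ∈ T ↔ ∃ B p, IsHalfTree P c τ x₀ S B p := by
    simp only [T, Finset.mem_filter, Finset.mem_powerset, and_iff_right_iff_imp]
    rintro ⟨B, p, hS⟩
    exact hS.subset
  have hne : {x₀} ∈ T := by
    refine (hT _).2 ⟨∅, Function.update (PathConnectedSpace.somePath x₀) x₀ (Path.refl x₀),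
      by simp, by simpa using hx₀, ?_, by simp, by simp, by simp, by simp, by simp, by simp⟩
    simpa using hfree x₀
  obtain ⟨S, hST, hmax⟩ := T.exists_max_image Finset.card ⟨_, hne⟩
  obtain ⟨B, p, hS⟩ := (hT S).1 hST
  refine ⟨S, B, p, hS, ?_⟩
  by_contra! hcon
  obtain ⟨w, hwP, hw, hτw⟩ := hcon
  have hnot (e : E) (u v : X) (hu : u ∈ S) (hvP : v ∈ P) (hv : v ∉ S) (hτv : τ v ∉ S)
      (huv : u = c e 0 ∧ v = c e 1 ∨ u = c e 1 ∧ v = c e 0) : False := by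
    obtain ⟨p', hp'⟩ := hS.exists_insert hτ hfree hu hvP hv hτv huv
    have := hmax _ ((hT _).2 ⟨_, p', hp'⟩)
    rw [Finset.card_insert_of_notMem hv] at this
    omega
  have hnot' (e : E) (u v : X) (hu : u ∈ S ∨ τ u ∈ S) (hvP : v ∈ P) (hv : ¬ (v ∈ S ∨ τ v ∈ S))
      (huv : u = c e 0 ∧ v = c e 1 ∨ u = c e 1 ∧ v = c e 0) : False := by
    rw [not_or] at hv
    rcases hu with hu | hu
    · exact hnot e u v hu hvP hv.1 hv.2 huv
    · refine hnot (ι e) (τ u) (τ v) hu (hP _ hvP) hv.2 (by rw [hτ]; exact hv.1) ?_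
      rcases huv with ⟨rfl, rfl⟩ | ⟨rfl, rfl⟩
      exacts [.inl ⟨(hι e 0).symm, (hι e 1).symm⟩, .inr ⟨(hι e 1).symm, (hι e 0).symm⟩]
  obtain ⟨e, ⟨h0, h1⟩ | ⟨h1, h0⟩⟩ := h.exists_edge_leaving (W := {v | v ∈ S ∨ τ v ∈ S}) hx₀ hwP
    (.inl hS.root) (fun hw' => hw'.elim hw hτw)
  · exact hnot' e _ _ h0 (h.one_mem e) h1 (.inl ⟨rfl, rfl⟩)
  · exact hnot' e _ _ h1 (h.zero_mem e) h0 (.inr ⟨rfl, rfl⟩)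

end IsHalfTree

/-! ### Counting orbits and the equivariant loop basis -/

lemma Finset.card_eq_two_mul_of_involution {α : Type*} {Q S : Finset α} (ι : α → α)
    (hι : ∀ x, ι (ι x) = x) (hQ : ∀ x ∈ Q, ι x ∈ Q) (hSQ : S ⊆ Q)
    (hS : ∀ x ∈ Q, x ∈ S ↔ ι x ∉ S) : Q.card = 2 * S.card := by
  classical
  have hinj : Function.Injective ι := (show Function.Involutive ι from hι).injective
  have h1 : Q \ S = S.image ι := by
    ext x
    simp only [Finset.mem_sdiff, Finset.mem_image]
    constructor
    · rintro ⟨hx, hxS⟩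
      exact ⟨ι x, not_not.1 fun h => hxS ((hS x hx).2 h), hι x⟩
    · rintro ⟨y, hy, rfl⟩
      exact ⟨hQ y (hSQ hy), (hS y (hSQ hy)).1 hy⟩
  have h2 := Finset.card_sdiff_add_card_eq_card hSQ
  rw [h1, Finset.card_image_of_injective _ hinj] at h2
  omega

namespace IsGraphDecomposition

variable {X E : Type*} [TopologicalSpace X] {P : Finset X} {c : E → C(I, X)}

/-- There is a map to the circle with prescribed winding numbers along the edges. -/
lemma exists_map_wind_edgePath [T2Space X] [Finite E] (h : IsGraphDecomposition P c) (k : E → ℤ) :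
    ∃ f : C(X, Circle), (∀ v ∈ P, f v = 1) ∧ ∀ e, wind f (edgePath c e) = k e := by
  obtain ⟨f, hfP, hf⟩ := h.exists_glue (fun _ => (1 : Circle))
    (fun e => ⟨fun t : I => turn (k e * t), by fun_prop⟩) (by simp) (by simp [turn_intCast])
  refine ⟨f, hfP, fun e => ?_⟩
  rw [wind_eq (F := fun t : I => (k e : ℝ) * t) (by fun_prop) (fun t => (hf e t).symm)]
  simp

/-- A map to the circle lifts if its winding numbers along the edges are the differences of a
function on the vertices that lifts it there. -/
lemma exists_lift_of_wind_edgePath [T2Space X] [Finite E] (h : IsGraphDecomposition P c)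
    {f : C(X, Circle)} {a : Circle} {u : X → ℝ} (hu : ∀ v ∈ P, f v = a * turn (u v))
    (hf : ∀ e, wind f (edgePath c e) = u (c e 1) - u (c e 0)) :
    ∃ θ : C(X, ℝ), (∀ v ∈ P, θ v = u v) ∧ ∀ x, f x = a * turn (θ x) := by
  choose F hF hFw using fun e => exists_lift_wind f (edgePath c e)
  obtain ⟨θ, hθP, hθ⟩ := h.exists_glue u
    (fun e => ⟨fun t => u (c e 0) + (F e t - F e 0), by fun_prop⟩) (by simp)
    (fun e => by
      have h1 := (hFw e).symm.trans (hf e)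
      simp only [ContinuousMap.coe_mk]
      linarith)
  have hP (x : X) (hx : x ∈ P) : f x = a * turn (θ x) := by rw [hθP x hx, hu x hx]
  refine ⟨θ, hθP, fun x => ?_⟩
  rcases h.cover x with hx | ⟨e, t, -, rfl⟩
  · exact hP x hx
  · have hθe : θ (c e t) = u (c e 0) + (F e t - F e 0) := hθ e t
    rw [hθe, turn_add, turn_sub, hF, hF, (edgePath c e).source, ← mul_assoc,
      ← hu _ (h.zero_mem e)]
    exact (mul_div_cancel _ _).symm

end IsGraphDecomposition

/-- The tree `S`, its translate and `e₀` together form a spanning tree. The edge `ι e₀` accounts for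
the loop `c · τc`, and each remaining edge orbit, represented in `R`, for two loops; so `m =
R.card`. -/
lemma IsHalfTree.exists_equivariantLoopBasis {X E : Type*} [TopologicalSpace X] [T2Space X]
    [PreconnectedSpace X] [Fintype E] [LinearOrder E] {P : Finset X} {c : E → C(I, X)}
    {τ : C(X, X)} {x₀ : X} {S : Finset X} {B : Finset E} {p : ∀ v, Path x₀ v}
    (hT : IsHalfTree P c τ x₀ S B p) (hS : ∀ v ∈ P, v ∈ S ∨ τ v ∈ S)
    (h : IsGraphDecomposition P c) (hτ : ∀ x, τ (τ x) = x) (hP : ∀ x ∈ P, τ x ∈ P)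
    {ι : E → E} (hι : ∀ e, ι (ι e) = e) (hιe : ∀ e, ι e ≠ e) (hιc : ∀ e t, c (ι e) t = τ (c e t)) :
    ∃ m, Fintype.card E = P.card + 2 * m ∧ Nonempty (EquivariantLoopBasis τ x₀ m) := by
  classical
  have hx₀ : x₀ ∈ P := hT.subset hT.root
  obtain ⟨e₀, he₀, he₀'⟩ : ∃ e, c e 0 ∈ S ∧ c e 1 ∉ S := by
    -- If the edge found leaves `S` at its end rather than its start, its translate has the required
    -- direction.
    obtain ⟨e, ⟨h0, h1⟩ | ⟨h1, h0⟩⟩ := h.exists_edge_leaving (W := S) hx₀ (hP _ hx₀)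
      hT.root (hT.notMem _ hT.root)
    · exact ⟨e, h0, h1⟩
    · refine ⟨ι e, ?_, ?_⟩ <;> rw [hιc]
      exacts [(hS _ (h.zero_mem e)).resolve_left h0, hT.notMem _ h1]
  have hw : τ (c e₀ 1) ∈ S := (hS _ (h.one_mem e₀)).resolve_left he₀'
  have hcomp (f : C(X, Circle)) : (f.comp τ).comp τ = f := by ext x; simp [hτ]
  have hedge (f : C(X, Circle)) (e : E) :
      wind (f.comp τ) (edgePath c e) = wind f (edgePath c (ι e)) :=
    (wind_edgePath_comp hιc f e).symm
  have hBS (e : E) (he : e ∈ B) : ι e ∉ B := fun he' =>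
    hT.notMem _ (hT.zero_mem e he) (hιc e 0 ▸ hT.zero_mem _ he')
  have he₀B : e₀ ∉ B := fun he => he₀' (hT.one_mem _ he)
  have hιe₀B : ι e₀ ∉ B := fun he => hT.notMem _ he₀ (hιc e₀ 0 ▸ hT.zero_mem _ he)
  let w : Path x₀ (τ x₀) := ((p (c e₀ 0)).trans (edgePath c e₀)).trans
    (((p (τ (c e₀ 1))).map τ.continuous).cast rfl (hτ _).symm).symm
  have hwf (f : C(X, Circle)) : wind f w =
      wind f (p (c e₀ 0)) + wind f (edgePath c e₀) - wind (f.comp τ) (p (τ (c e₀ 1))) := by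
    rw [wind_trans, wind_trans, wind_symm, wind_cast, wind_map, sub_eq_add_neg]
  -- The winding of `f` from `x₀` to `v` along the spanning tree: directly inside `S`, otherwise
  -- through `w` and the translated tree. It is the candidate lift of `f / f x₀` on vertices.
  let U : C(X, Circle) → X → ℝ := fun f v =>
    if v ∈ S then wind f (p v) else wind f w + wind (f.comp τ) (p (τ v))
  have hU (f : C(X, Circle)) {v : X} (hv : v ∈ S) : U f v = wind f (p v) := if_pos hv
  have hU' (f : C(X, Circle)) {v : X} (hv : v ∉ S) :
      U f v = wind f w + wind (f.comp τ) (p (τ v)) := if_neg hv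
  have hex (v : X) : ∃ q : Path x₀ v, ∀ f, wind f q = U f v := by
    by_cases hv : v ∈ S
    · exact ⟨p v, fun f => (hU f hv).symm⟩
    · refine ⟨w.trans (((p (τ v)).map τ.continuous).cast rfl (hτ v).symm), fun f => ?_⟩
      rw [hU' f hv, wind_trans, wind_cast, wind_map]
  choose q hq using hex
  -- Vanishing winding along `w · τw` makes `U` equivariant up to a constant, so edge differences
  -- for `f ∘ τ` turn into those for `f` on translated edges.
  have hUτ (f : C(X, Circle)) (hf : wind f w + wind (f.comp τ) w = 0) {v : X} (hv : v ∈ P) :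
      U (f.comp τ) v = U f (τ v) - wind f w := by
    by_cases hvS : v ∈ S
    · rw [hU _ hvS, hU' _ (hT.notMem v hvS), hτ]
      ring
    · rw [hU' _ hvS, hU _ ((hS v hv).resolve_left hvS), hcomp]
      linarith
  let g : ∀ e, Path x₀ x₀ := fun e =>
    ((q (c e 0)).trans (edgePath c e)).trans (q (c e 1)).symm
  have hg (f : C(X, Circle)) (e : E) :
      wind f (g e) = U f (c e 0) + wind f (edgePath c e) - U f (c e 1) := by
    rw [wind_trans, wind_trans, wind_symm, hq, hq, sub_eq_add_neg]
  let D : E → Prop := fun e => e ∈ B ∨ ι e ∈ B ∨ e = e₀ ∨ ι e = e₀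
  have hDι (e : E) : D (ι e) ↔ D e := by
    simp only [D, hι]
    tauto
  let R : Finset E := Finset.univ.filter fun e => ¬ D e ∧ e < ι e
  have hR (e : E) : e ∈ R ↔ ¬ D e ∧ e < ι e := by simp [R]
  have hcases (e : E) : D e ∨ e ∈ R ∨ ι e ∈ R := by
    by_cases hD : D e
    · exact .inl hD
    · right
      rw [hR, hR, hDι, hι]
      rcases lt_or_gt_of_ne (hιe e) with h1 | h1
      exacts [.inr ⟨hD, h1⟩, .inl ⟨hD, h1⟩]
  have hRι (e : E) (he : e ∈ R) : ι e ∉ R := fun he' => by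
    rw [hR] at he he'
    rw [hι] at he'
    exact he.2.not_gt he'.2
  have hRD (e : E) (he : e ∈ R) : ¬ D e := ((hR e).1 he).1
  have hcardP : P.card = 2 * S.card :=
    Finset.card_eq_two_mul_of_involution τ hτ hP hT.subset fun v hv =>
      ⟨hT.notMem v, fun h1 => (hS v hv).resolve_right h1⟩
  have hcardE : Fintype.card E = 2 * (insert e₀ (B ∪ R)).card := by
    refine Finset.card_eq_two_mul_of_involution ι hι (by simp) (Finset.subset_univ _) fun e _ => ?_
    simp only [Finset.mem_insert, Finset.mem_union, not_or]
    constructor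
    · rintro (rfl | he | he)
      · exact ⟨hιe _, hιe₀B, fun h1 => hRD _ h1 ((hDι _).2 (.inr (.inr (.inl rfl))))⟩
      · refine ⟨fun h1 => hιe₀B (by rwa [← h1, hι]), hBS e he,
          fun h1 => hRD _ h1 ((hDι _).2 (.inl he))⟩
      · exact ⟨fun h1 => hRD _ he (.inr (.inr (.inr h1))), fun h1 => hRD _ he (.inr (.inl h1)),
          hRι e he⟩
    · rintro ⟨h1, h2, h3⟩
      rcases hcases e with (h4 | h4 | h4 | h4) | h4 | h4
      exacts [.inr (.inl h4), absurd h4 h2, .inl h4, absurd h4 h1, .inr (.inr h4), absurd h4 h3]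
  have hcardX : (insert e₀ (B ∪ R)).card = S.card + R.card := by
    have h1 : e₀ ∉ R := fun h2 => hRD _ h2 (.inr (.inr (.inl rfl)))
    have h2 : Disjoint B R := Finset.disjoint_left.2 fun e he he' => hRD e he' (.inl he)
    rw [Finset.card_insert_of_notMem (by simp [he₀B, h1]), Finset.card_union_of_disjoint h2,
      hT.card]
    omega
  refine ⟨R.card, by omega, ⟨⟨w, fun i => g (R.equivFin.symm i), fun f hf hf1 hf2 => ?_,
    fun n a b => ?_⟩⟩⟩
  · have hgood_of (f : C(X, Circle)) (hf : ∀ i, wind f (g (R.equivFin.symm i)) = 0) (e : E)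
        (he : e ∈ B ∨ e = e₀ ∨ e ∈ R) :
        wind f (edgePath c e) = U f (c e 1) - U f (c e 0) := by
      rcases he with he | rfl | he
      · rw [hU f (hT.zero_mem e he), hU f (hT.one_mem e he), hT.wind_edge f e he]
      · rw [hU f he₀, hU' f he₀', hwf]
        ring
      · have h1 := hf (R.equivFin ⟨e, he⟩)
        rw [Equiv.symm_apply_apply, hg] at h1
        linarith
    have hf' : wind (f.comp τ) w + wind ((f.comp τ).comp τ) w = 0 := by
      rw [hcomp, add_comm, hf]
    have hgood (e : E) : wind f (edgePath c e) = U f (c e 1) - U f (c e 0) := by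
      have h1 : (e ∈ B ∨ e = e₀ ∨ e ∈ R) ∨ (ι e ∈ B ∨ ι e = e₀ ∨ ι e ∈ R) := by
        rcases hcases e with (h4 | h4 | h4 | h4) | h4 | h4 <;> tauto
      rcases h1 with h1 | h1
      · exact hgood_of f hf1 e h1
      · have h2 := hgood_of (f.comp τ) hf2 _ h1
        rw [hedge, hι, hUτ f hf (h.one_mem _), hUτ f hf (h.zero_mem _), hιc, hιc, hτ, hτ] at h2
        linarith
    obtain ⟨θ, hθP, hθ⟩ := h.exists_lift_of_wind_edgePath (a := f x₀) (u := U f)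
      (fun v _ => by rw [← hq, turn_wind]; exact (mul_div_cancel _ _).symm) hgood
    exact ⟨θ, by rw [hθP _ hx₀, hU f hT.root, hT.wind_root], hθ⟩
  -- `d` anticipates `U (f.comp τ)` on vertices: only `ι e₀` carries the winding `n`, so `τw` winds
  -- `n` times and tree paths not at all. The edges in `ι R` are corrected by differences of `d` so
  -- that `f ∘ τ` winds `b i` times along the loops.
  · let d : X → ℤ := fun v => if v ∈ S then 0 else n
    let a' : E → ℤ := fun e => if he : e ∈ R then a (R.equivFin ⟨e, he⟩) else 0
    let b' : E → ℤ := fun e => if he : e ∈ R then b (R.equivFin ⟨e, he⟩) else 0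
    have ha' (i) : a' (R.equivFin.symm i) = a i := by simp [a']
    have hb' (i) : b' (R.equivFin.symm i) = b i := by simp [b']
    obtain ⟨f, hfP, hf⟩ := h.exists_map_wind_edgePath fun e =>
      if e = ι e₀ then n else if e ∈ R then a' e else
        if ι e ∈ R then b' (ι e) - d (c (ι e) 0) + d (c (ι e) 1) else 0
    have hRe₀ (e : E) (he : e ∈ R) : e ≠ ι e₀ := by
      rintro rfl
      exact hRD _ he (.inr (.inr (.inr (hι _))))
    have hRe₀' (e : E) (he : e ∈ R) : ι e ≠ ι e₀ := fun h1 =>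
      hRD _ he (.inr (.inr (.inl (by rw [← hι e, h1, hι]))))
    have hfD (e : E) (hD : D e) (he : e ≠ ι e₀) : wind f (edgePath c e) = 0 := by
      rw [hf, if_neg he, if_neg fun h1 => hRD _ h1 hD,
        if_neg fun h1 => hRD _ h1 ((hDι e).2 hD), Int.cast_zero]
    have hfe₀ : wind f (edgePath c (ι e₀)) = n := by rw [hf, if_pos rfl]
    have hp (v : X) (hv : v ∈ S) : wind f (p v) = 0 :=
      hT.wind_eq_zero f (fun e he => hfD e (.inl he) fun h1 => hιe₀B (h1 ▸ he)) v hv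
    have hpτ (v : X) (hv : v ∈ S) : wind (f.comp τ) (p v) = 0 := by
      refine hT.wind_eq_zero _ (fun e he => ?_) v hv
      rw [hedge]
      refine hfD _ ((hDι e).2 (.inl he)) fun h1 => he₀B ?_
      rwa [← hι e₀, ← h1, hι]
    have hw0 : wind f w = 0 := by
      rw [hwf, hp _ he₀, hpτ _ hw, hfD e₀ (.inr (.inr (.inl rfl))) (hιe e₀).symm]
      ring
    have hwn : wind (f.comp τ) w = n := by
      rw [hwf, hpτ _ he₀, hcomp, hp _ hw, hedge, hfe₀]
      ring
    have hUf (v : X) (hv : v ∈ P) : U f v = 0 := by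
      by_cases hvS : v ∈ S
      · rw [hU _ hvS, hp v hvS]
      · rw [hU' _ hvS, hw0, hpτ _ ((hS v hv).resolve_left hvS), add_zero]
    have hUfτ (v : X) (hv : v ∈ P) : U (f.comp τ) v = d v := by
      by_cases hvS : v ∈ S
      · rw [hU _ hvS, hpτ v hvS]
        simp [d, hvS]
      · rw [hU' _ hvS, hwn, hcomp, hp _ ((hS v hv).resolve_left hvS), add_zero]
        simp [d, hvS]
    refine ⟨f, hfP _ hx₀, by rw [hw0, hwn, zero_add], fun i => ?_, fun i => ?_⟩
    · have hmem : (R.equivFin.symm i : E) ∈ R := (R.equivFin.symm i).2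
      rw [hg, hUf _ (h.zero_mem _), hUf _ (h.one_mem _), hf, if_neg (hRe₀ _ hmem), if_pos hmem, ha']
      ring
    · have hmem : (R.equivFin.symm i : E) ∈ R := (R.equivFin.symm i).2
      rw [hg, hUfτ _ (h.zero_mem _), hUfτ _ (h.one_mem _), hedge, hf, if_neg (hRe₀' _ hmem),
        if_neg (hRι _ hmem), hι, if_pos hmem, hb']
      push_cast
      ring

/-! ### The theorem -/

theorem theorem1p3 {Γ G : Type*} [TopologicalSpace Γ] [T2Space Γ] [ConnectedSpace Γ]
    [CWComplex (univ : Set Γ)] [IsFiniteGraph Γ]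
    (τ : Γ → Γ) (hτ : IsFreeInvolution τ)
    [TopologicalSpace G] (hG : Nonempty (G ≃ₜ Circle)) (x₀ : Γ) (g₀ : G) :
    ∃ m : ℕ, graphEulerChar Γ = -2 * (m : ℤ) ∧
      ∃ (z : FundamentalGroup G g₀) (γ : Fin (2 * m + 1) → FundamentalGroup Γ x₀)
        (E : BasedHomotopyClass x₀ g₀ ≃ (Fin (2 * m + 1) → ℤ)),
        -- `π₁(G, g₀)` is infinite cyclic, generated by `z`
        Function.Bijective (fun n : ℤ => z ^ n) ∧
        -- `E` evaluates the induced homomorphism at `γ 0, …, γ (2m)`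
        (∀ (f : BasedMap x₀ g₀) (i : Fin (2 * m + 1)), f.induced (γ i) = z ^ E f.toClass i) ∧
        -- the property fails exactly for the tuples `(p, p₁, p₁, …, p_m, p_m)` with `p` odd
        ∀ α : BasedHomotopyClass x₀ g₀,
          ¬ BorsukUlamHolds τ α ↔
            Odd (E α ⟨0, by omega⟩) ∧
              ∀ i : Fin m, E α ⟨2 * (i : ℕ) + 1, by omega⟩ = E α ⟨2 * (i : ℕ) + 2, by omega⟩ := by
  classical
  let t : C(Γ, Γ) := ⟨τ, hτ.continuous⟩
  have ht : ∀ x, t (t x) = x := hτ.involutive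
  obtain ⟨V, n, c₀, hc₀, hχ⟩ := exists_isGraphDecomposition (Γ := Γ)
  -- The given vertices need be neither `τ`-invariant nor contain `x₀`; enlarging them to `P`
  -- achieves both by subdivision.
  let P : Finset Γ := V ∪ (V.image t ∪ {x₀, t x₀})
  obtain ⟨k, c₁, hc₁, hk⟩ := hc₀.exists_superset (V.image t ∪ {x₀, t x₀})
  have hP : ∀ x ∈ P, t x ∈ P := by
    intro x hx
    simp only [P, Finset.mem_union, Finset.mem_image, Finset.mem_insert,
      Finset.mem_singleton] at hx ⊢
    rcases hx with hx | ⟨y, hy, rfl⟩ | rfl | rfl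
    · exact .inr (.inl ⟨x, hx, rfl⟩)
    · exact .inl ((ht y).symm ▸ hy)
    · exact .inr (.inr (.inr rfl))
    · exact .inr (.inr (.inl (ht x₀)))
  have hx₀ : x₀ ∈ P := by simp [P]
  obtain ⟨ι, c, hι, hιe, hc, hιc⟩ := hc₁.exists_equivariant ht hτ.apply_ne hP
  obtain ⟨S, B, p, hT, hS⟩ := IsHalfTree.exists_spanning hc ht hτ.apply_ne hP hιc hx₀
  obtain ⟨m, hm, ⟨L⟩⟩ := hT.exists_equivariantLoopBasis hS hc ht hP hι hιe hιc
  refine ⟨m, ?_, exists_classification L ht hG⟩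
  rw [Fintype.card_fin] at hm
  rw [← hχ, ← hk, hm]
  push_cast
  ring
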